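/- Let $n\ge 1$ and let $w\in R_n=[2^{n-1},2^n-1]$ have binary representation $w=b_1b_2\dots b_n$ (so $b_1=1$), with internal block $B=b_2b_3\dots b_{n-1}$ (empty if $n\le 2$). The W-RPG codec encodes $w$ as follows. Let $B'=0^n\,b_1\dots b_n\,0$, a word of length $2n+1$, and let $B^*$ be its bitwise complement. Let $X$ and $Y$ be the increasing sequences of the positions of the $0$s and of the $1$s of $B^*$, respectively, and let $\pi^b=(\pi^b_1,\dots,\pi^b_{2n+1})$ be $X$ followed by the reversal of $Y$. The self-inverting permutation $\pi^*$ of $\{1,\dots,2n+1\}$ is the one with $\pi^*(\pi^b_i)=\pi^b_{2n+2-i}$ for $1\le i\le 2n+1$. For $1\le i\le 2n+1$ let $\mathrm{dmax}(i)$ be the rightmost element among the elements of the sequence $(\pi^*_1,\dots,\pi^*_{2n+1})$ that lie to the left of $i$ and are greater than $i$, and $\mathrm{dmax}(i)=2n+2$ if there is no such element. The reducible permutation graph $F[\pi^*]$ is the directed graph on the nodes $0,1,\dots,2n+2$ with the forward edges $(i+1,i)$, $0\le i\le 2n+1$, and the back edges $(i,\mathrm{dmax}(i))$, $1\le i\le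 2n+1$. An edge modification of a directed graph replaces one of its edges by an ordered pair of nodes that is not an edge. Let ${\tt minVM}(w)$ be the least number of successive edge modifications that turn $F[\pi^*]$ into the graph $F[\phi^*]$ that encodes some $w'\in R_n$ with $w'\ne w$ (equality of graphs on the labelled nodes $0,\dots,2n+2$). Then: 1. If $B$ contains at least two $0$s, then ${\tt minVM}(w)=3$. 2. If $B$ contains exactly one $0$, that is, $B=1^{\ell}01^{r}$ with $\ell,r\ge 0$, then $$ {\tt minVM}(w)=\begin{cases} 4+\min\{\ell,r-1\}, & \text{if } b_n=0 \text{ and } r>0,\\ 4, & \text{if } b_n=0 \text{ and } r=0,\\ 4+\min\{\ell,r\}, & \text{if } b_n=1. \end{cases} $$ 3. If $B$ contains no $0$s and $n\ge 4$, then ${\tt minVM}(w)=4$. -/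

import Mathlib

/-! Encoding of watermark numbers as self-inverting permutations and as reducible
permutation graphs, and the least number of edge modifications between two such graphs. -/

namespace WRPG

/-- The range `R_n = [2^(n-1), 2^n - 1]` of the numbers whose binary representation has
length `n`. -/
def InRange (n w : ℕ) : Prop := 2 ^ (n - 1) ≤ w ∧ w ≤ 2 ^ n - 1

/-- The bit `b_i` of `w = b_1 b_2 … b_n`, with `b_1` the most significant bit. -/
def bit (n w i : ℕ) : Bool := w.testBit (n - i)

/-- The internal block `B = b_2 b_3 … b_{n-1}`. -/
def internalBlock (n w : ℕ) : List Bool := (List.range' 2 (n - 2)).map (bit n w)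

/-- The `i`-th entry, `1 ≤ i ≤ 2n+1`, of the binary word `B*`: the bitwise complement of
`B' = 0…0 ‖ b_1 … b_n ‖ 0`, which starts with `n` zeros. -/
def starBit (n w i : ℕ) : Bool :=
  if n < i ∧ i ≤ 2 * n then !(bit n w (i - n)) else true

/-- The increasing sequence `X` of the positions of the 0s of `B*`. -/
def zeroPos (n w : ℕ) : List ℕ :=
  (List.range' 1 (2 * n + 1)).filter fun i => !(starBit n w i)

/-- The increasing sequence `Y` of the positions of the 1s of `B*`. -/
def onePos (n w : ℕ) : List ℕ :=
  (List.range' 1 (2 * n + 1)).filter fun i => starBit n w i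

/-- The bitonic sequence `π^b = X ‖ Y^R`, an arrangement of `1, …, 2n+1`. -/
def bitonic (n w : ℕ) : List ℕ := zeroPos n w ++ (onePos n w).reverse

/-- The self-inverting permutation `π*` of `{1, …, 2n+1}` (values elsewhere are irrelevant):
it exchanges the `j`-th entry from the left of `π^b` with the `j`-th entry from the right, and
fixes the middle entry. -/
def sip (n w : ℕ) (i : ℕ) : ℕ :=
  (bitonic n w).getD (2 * n - (bitonic n w).idxOf i) 0

/-- `m = dmax(i)` for the sequence `(π 1, …, π N)`: among the elements that lie to the left of
`i` and are greater than `i`, `m` is the one with the greatest index; if there are none,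
`m = N + 1` (the root node `s`). -/
def IsDmax (N : ℕ) (π : ℕ → ℕ) (i m : ℕ) : Prop :=
  ∃ p ∈ Finset.Icc 1 N, π p = i ∧
    ((∃ j ∈ Finset.Ico 1 p, i < π j ∧ (∀ k ∈ Finset.Ioo j p, π k < i) ∧ m = π j) ∨
      ((∀ k ∈ Finset.Ico 1 p, π k < i) ∧ m = N + 1))

/-- The reducible permutation graph `F[π]` on the nodes `0 = t, 1, …, N, N + 1 = s`: forward
edges `(i + 1, i)`, and back edges `(i, dmax(i))` for `1 ≤ i ≤ N`. -/
def permGraph (N : ℕ) (π : ℕ → ℕ) : Digraph (Fin (N + 2)) where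
  Adj u v := (u : ℕ) = (v : ℕ) + 1 ∨ IsDmax N π u v

/-- The graph `F[π*]` that encodes the number `w` of binary length `n`. -/
def graph (n w : ℕ) : Digraph (Fin (2 * n + 1 + 2)) := permGraph (2 * n + 1) (sip n w)

/-- `H` results from `G` by one edge modification: one edge `(a, b)` of `G` is replaced by an
ordered pair `(c, d)` that is not an edge of `G`. -/
def EdgeModification {V : Type*} (G H : Digraph V) : Prop :=
  ∃ a b c d : V, G.Adj a b ∧ ¬ G.Adj c d ∧
    ∀ x y : V, H.Adj x y ↔ (G.Adj x y ∧ ¬ (x = a ∧ y = b)) ∨ (x = c ∧ y = d)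

/-- `H` results from `G` by `k` successive edge modifications. -/
def ModifiedIn {V : Type*} : ℕ → Digraph V → Digraph V → Prop
  | 0, G, H => G = H
  | k + 1, G, H => ∃ K : Digraph V, EdgeModification G K ∧ ModifiedIn k K H

/-- `minVM(w) = m`: some `m` edge modifications turn the graph of `w` into the graph of another
number in the range `R_n`, and no smaller number of edge modifications does. -/
def IsMinVM (n w m : ℕ) : Prop :=
  IsLeast {k : ℕ | ∃ w' : ℕ, InRange n w' ∧ w' ≠ w ∧ ModifiedIn k (graph n w) (graph n w')} m

end WRPG

/-! Two such graphs share their forward edges, and each of the nodes `1, …, 2n+1` has exactly one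
back edge. So the number of modifications needed is the number of nodes whose back edges differ,
`graphDist`.

Put `b_{n+1} = 0` and let `z_0 < z_1 < …` be the zeros. In `π^b` the nodes `n + i` with `b_i = 1`
come first, increasing, then those with `b_i = 0`, decreasing, then `n, …, 1`. Hence `π*` exchanges
the `k`-th one with `k`, exchanges `n + z_k` with `n + 1 - k` for `k ≥ 1`, and fixes `n + z_0`. An
upper node `n + i`, `i ≤ n`, therefore points to the root if `b_i = 1` and to the next zero
otherwise. A lower node `v ≤ n` points to the entry at the last zero before its own position: with
`M` zeros before it, the target is `n + 2 - M` if `M ≥ 2`, `n + z_0` if `M = 1`, and, as soon as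
`z_0 ≤ n`, `n + z_1` if `M = 0`.

If two zeros precede `b_n`, flipping `b_n` changes only three back edges (`graphDist_flip_last_le`).
Conversely, the first bit in which two words differ forces three changes (`three_le_graphDist`).
With fewer zeros, a change of `z_0` or `z_1` redirects a whole interval of lower nodes. For a single
internal zero at `z`, the cheap options are flipping `b_n`, which redirects the nodes below `z`, and
pushing the zero to the right end, which redirects the nodes from `z` on; the minimum of the two
costs is the answer (`OneZero.le_graphDist`, `TwoZeros.le_graphDist`). When the internal zero is at
`n - 1` and `b_n = 0`, the best competitor is the all-ones word. Words without internal zeros are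
settled by `four_le_graphDist_of_no_zero` and `OneZero.four_le_graphDist`. -/

namespace WRPG

/-! ### Edge modifications and symmetric differences of edge sets -/

section Distance

variable {V : Type*}

/-- The edges of `G` that are not edges of `H`. -/
def edgeDiff (G H : Digraph V) : Set (V × V) := {e | G.Adj e.1 e.2 ∧ ¬ H.Adj e.1 e.2}

/-- A single modification removes only one edge, so it disposes of at most one superfluous edge. -/
theorem ncard_edgeDiff_le_of_modifiedIn [Finite V] {H : Digraph V} :
    ∀ {k : ℕ} {G : Digraph V}, ModifiedIn k G H → (edgeDiff G H).ncard ≤ k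
  | 0, G, h => by
    have h : G = H := h
    subst h
    have : edgeDiff G G = ∅ := by ext e; simp [edgeDiff]
    simp [this]
  | k + 1, G, ⟨K, ⟨a, b, c, d, _, _, hK⟩, h⟩ => by
    have ih := ncard_edgeDiff_le_of_modifiedIn h
    have hsub : edgeDiff G H ⊆ insert (a, b) (edgeDiff K H) := by
      rintro ⟨x, y⟩ ⟨hG, hH⟩
      by_cases hxy : x = a ∧ y = b
      · left; simp [hxy]
      · right; exact ⟨(hK x y).2 (Or.inl ⟨hG, hxy⟩), hH⟩
    calc (edgeDiff G H).ncard ≤ (insert (a, b) (edgeDiff K H)).ncard :=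
          Set.ncard_le_ncard hsub (Set.toFinite _)
      _ ≤ (edgeDiff K H).ncard + 1 := Set.ncard_insert_le _ _
      _ ≤ k + 1 := by omega

/-- Each step trades a superfluous edge for a missing one, so both differences shrink by one; this
is why they must have equal size. -/
theorem modifiedIn_of_ncard_edgeDiff [Finite V] {H : Digraph V} :
    ∀ {k : ℕ} {G : Digraph V}, (edgeDiff G H).ncard = k → (edgeDiff H G).ncard = k →
      ModifiedIn k G H
  | 0, G, h₁, h₂ => by
    rw [Set.ncard_eq_zero (Set.toFinite _)] at h₁ h₂
    show G = H
    ext x y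
    constructor
    · intro hG
      by_contra hH
      exact (h₁ ▸ (⟨hG, hH⟩ : (x, y) ∈ edgeDiff G H) : (x, y) ∈ (∅ : Set (V × V)))
    · intro hH
      by_contra hG
      exact (h₂ ▸ (⟨hH, hG⟩ : (x, y) ∈ edgeDiff H G) : (x, y) ∈ (∅ : Set (V × V)))
  | k + 1, G, h₁, h₂ => by
    obtain ⟨⟨a, b⟩, hab⟩ : (edgeDiff G H).Nonempty :=
      (Set.ncard_pos (Set.toFinite _)).1 (by omega)
    obtain ⟨⟨c, d⟩, hcd⟩ : (edgeDiff H G).Nonempty :=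
      (Set.ncard_pos (Set.toFinite _)).1 (by omega)
    have hab' : G.Adj a b ∧ ¬ H.Adj a b := hab
    have hcd' : H.Adj c d ∧ ¬ G.Adj c d := hcd
    let K : Digraph V := ⟨fun x y => (G.Adj x y ∧ ¬ (x = a ∧ y = b)) ∨ (x = c ∧ y = d)⟩
    refine ⟨K, ⟨a, b, c, d, hab'.1, hcd'.2, fun _ _ => Iff.rfl⟩,
      modifiedIn_of_ncard_edgeDiff ?_ ?_⟩
    · have : edgeDiff K H = edgeDiff G H \ {(a, b)} := by
        ext ⟨x, y⟩
        simp only [edgeDiff, K, Set.mem_ofPred_eq, Set.mem_sdiff, Set.mem_singleton_iff,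
          Prod.mk.injEq]
        constructor
        · rintro ⟨h | ⟨rfl, rfl⟩, hH⟩
          · exact ⟨⟨h.1, hH⟩, h.2⟩
          · exact absurd hcd'.1 hH
        · rintro ⟨⟨hG, hH⟩, hne⟩
          exact ⟨Or.inl ⟨hG, hne⟩, hH⟩
      rw [this, Set.ncard_sdiff_singleton_of_mem hab, h₁]
      rfl
    · have : edgeDiff H K = edgeDiff H G \ {(c, d)} := by
        ext ⟨x, y⟩
        simp only [edgeDiff, K, Set.mem_ofPred_eq, Set.mem_sdiff, Set.mem_singleton_iff,
          Prod.mk.injEq]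
        constructor
        · rintro ⟨hH, hK⟩
          push Not at hK
          refine ⟨⟨hH, fun hG => ?_⟩, fun h => hK.2 h.1 h.2⟩
          obtain ⟨rfl, rfl⟩ := hK.1 hG
          exact hab'.2 hH
        · rintro ⟨⟨hH, hG⟩, hne⟩
          exact ⟨hH, by rintro (h | h); exacts [hG h.1, hne h]⟩
      rw [this, Set.ncard_sdiff_singleton_of_mem hcd, h₂]
      rfl

/-- `D` computes the target of the back edge of each node of `F[π]`. -/
structure IsDmaxFun (N : ℕ) (π D : ℕ → ℕ) : Prop where
  iff : ∀ i m, IsDmax N π i m ↔ i ∈ Finset.Icc 1 N ∧ m = D i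
  lt : ∀ i ∈ Finset.Icc 1 N, i < D i
  le : ∀ i ∈ Finset.Icc 1 N, D i ≤ N + 1

/-- The nodes of `{1, …, N}` at which `D` and `D'` differ. -/
def diffNodes (N : ℕ) (D D' : ℕ → ℕ) : Finset ℕ := (Finset.Icc 1 N).filter fun i => D i ≠ D' i

theorem diffNodes_comm (N : ℕ) (D D' : ℕ → ℕ) : diffNodes N D D' = diffNodes N D' D := by
  simp only [diffNodes, ne_comm]

/-- A lost edge is a back edge and is determined by its source. Back edges go upwards, so none of
them can coincide with a forward edge of the other graph. -/
theorem ncard_edgeDiff_permGraph {N : ℕ} {π π' D D' : ℕ → ℕ} (h : IsDmaxFun N π D)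
    (h' : IsDmaxFun N π' D') :
    (edgeDiff (permGraph N π) (permGraph N π')).ncard = (diffNodes N D D').card := by
  have hmem : ∀ e : Fin (N + 2) × Fin (N + 2), e ∈ edgeDiff (permGraph N π) (permGraph N π') ↔
      (e.1 : ℕ) ∈ Finset.Icc 1 N ∧ (e.2 : ℕ) = D e.1 ∧ D e.1 ≠ D' e.1 := by
    rintro ⟨u, v⟩
    simp only [edgeDiff, permGraph, Set.mem_ofPred_eq, h.iff, h'.iff]
    constructor
    · rintro ⟨h₁, h₂⟩
      push Not at h₂
      rcases h₁ with h₁ | ⟨h₁, h₃⟩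
      · exact absurd h₁ h₂.1
      · exact ⟨h₁, h₃, h₃ ▸ h₂.2 h₁⟩
    · rintro ⟨h₁, h₂, h₃⟩
      refine ⟨Or.inr ⟨h₁, h₂⟩, ?_⟩
      have := h.lt _ h₁
      rintro (h₄ | h₄)
      · omega
      · exact h₃ (h₂ ▸ h₄.2)
  have himg : (fun e : Fin (N + 2) × Fin (N + 2) => (e.1 : ℕ)) ''
      edgeDiff (permGraph N π) (permGraph N π') = (diffNodes N D D' : Set ℕ) := by
    ext i
    simp only [Set.mem_image, hmem, diffNodes, Finset.coe_filter, Set.mem_ofPred_eq]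
    constructor
    · rintro ⟨e, ⟨h₁, h₂, h₃⟩, rfl⟩
      exact ⟨h₁, h₃⟩
    · rintro ⟨h₁, h₃⟩
      have h₄ := h.le i h₁
      have h₅ := Finset.mem_Icc.1 h₁
      exact ⟨(⟨i, by omega⟩, ⟨D i, by omega⟩), ⟨h₁, rfl, h₃⟩, rfl⟩
  rw [← Set.ncard_coe_finset, ← himg, Set.InjOn.ncard_image]
  rintro ⟨u, v⟩ he ⟨u', v'⟩ he' (huv : (u : ℕ) = u')
  have h₁ := ((hmem _).1 he).2.1
  have h₂ := ((hmem _).1 he').2.1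
  simp only at h₁ h₂
  rw [Prod.mk.injEq]
  exact ⟨Fin.ext huv, Fin.ext (by rw [h₁, h₂, huv])⟩

theorem le_of_modifiedIn_permGraph {N k : ℕ} {π π' D D' : ℕ → ℕ} (h : IsDmaxFun N π D)
    (h' : IsDmaxFun N π' D') (hk : ModifiedIn k (permGraph N π) (permGraph N π')) :
    (diffNodes N D D').card ≤ k :=
  ncard_edgeDiff_permGraph h h' ▸ ncard_edgeDiff_le_of_modifiedIn hk

theorem modifiedIn_permGraph {N : ℕ} {π π' D D' : ℕ → ℕ} (h : IsDmaxFun N π D)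
    (h' : IsDmaxFun N π' D') :
    ModifiedIn (diffNodes N D D').card (permGraph N π) (permGraph N π') :=
  modifiedIn_of_ncard_edgeDiff (ncard_edgeDiff_permGraph h h')
    (diffNodes_comm N D D' ▸ ncard_edgeDiff_permGraph h' h)

end Distance

/-! ### The self-inverting permutation in terms of the bits -/

section Permutation

variable {n w : ℕ}

/-- Whether `i` is one of the positions `1, …, n` and `b_i = 1`. -/
def isOne (n w i : ℕ) : Bool := decide (1 ≤ i) && decide (i ≤ n) && bit n w i

/-- The positions `i ≥ 1` with `b_i = 0`, where `b_i = 0` for `i > n`. -/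
def IsZero (n w i : ℕ) : Prop := 1 ≤ i ∧ isOne n w i = false

instance (n w : ℕ) : DecidablePred (IsZero n w) := fun _ => instDecidableAnd

/-- The number of ones at positions less than `i`. -/
def onesBefore (n w i : ℕ) : ℕ := Nat.count (fun j => isOne n w j = true) i

/-- The number of zeros at positions less than `i`. -/
def zerosBefore (n w i : ℕ) : ℕ := Nat.count (IsZero n w) i

theorem isOne_iff {i : ℕ} : isOne n w i = true ↔ 1 ≤ i ∧ i ≤ n ∧ bit n w i = true := by
  simp [isOne, and_assoc]

theorem onesBefore_add_zerosBefore (i : ℕ) :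
    onesBefore n w (i + 1) + zerosBefore n w (i + 1) = i := by
  induction i with
  | zero => simp [onesBefore, zerosBefore, Nat.count_succ, isOne, IsZero]
  | succ i ih =>
    rw [onesBefore, zerosBefore, Nat.count_succ, Nat.count_succ _ (i + 1)]
    rw [onesBefore, zerosBefore] at ih
    cases h : isOne n w (i + 1) <;> simp [IsZero, h] <;> omega

theorem onesBefore_succ_of_one {i : ℕ} (h : isOne n w i = true) :
    onesBefore n w (i + 1) = onesBefore n w i + 1 := by
  simp [onesBefore, Nat.count_succ, h]

theorem zerosBefore_succ_of_one {i : ℕ} (h : isOne n w i = true) :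
    zerosBefore n w (i + 1) = zerosBefore n w i := by
  simp [zerosBefore, Nat.count_succ, IsZero, h]

theorem onesBefore_succ_of_zero {i : ℕ} (h : IsZero n w i) :
    onesBefore n w (i + 1) = onesBefore n w i := by
  simp [onesBefore, Nat.count_succ, h.2]

theorem zerosBefore_succ_of_zero {i : ℕ} (h : IsZero n w i) :
    zerosBefore n w (i + 1) = zerosBefore n w i + 1 := by
  simp [zerosBefore, Nat.count_succ, h]

theorem onesBefore_mono : Monotone (onesBefore n w) := Nat.count_monotone _

theorem zerosBefore_mono : Monotone (zerosBefore n w) := Nat.count_monotone _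

/-- The number of zeros of `B*` at positions less than `a`. -/
def starZerosBefore (n w a : ℕ) : ℕ :=
  ((List.range' 1 (a - 1)).filter fun i => !(starBit n w i)).length

theorem starZerosBefore_succ {a : ℕ} (ha : 1 ≤ a) :
    starZerosBefore n w (a + 1) =
      starZerosBefore n w a + if starBit n w a then 0 else 1 := by
  obtain ⟨a, rfl⟩ : ∃ c, a = c + 1 := ⟨a - 1, by omega⟩
  simp only [starZerosBefore, Nat.add_sub_cancel, List.range'_1_concat, List.filter_append,
    List.length_append, Nat.add_comm 1 a]
  cases h : starBit n w (a + 1) <;> simp [h]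

theorem starBit_of_le {a : ℕ} (ha : a ≤ n) : starBit n w a = true := by
  rw [starBit, if_neg (by omega)]

theorem starBit_add {i : ℕ} (hi : 1 ≤ i) : starBit n w (n + i) = !(isOne n w i) := by
  by_cases h : i ≤ n
  · simp [starBit, isOne, h, hi, show n < n + i by omega, show n + i ≤ 2 * n by omega]
  · simp [starBit, isOne, h, show ¬ n + i ≤ 2 * n by omega]

theorem starZerosBefore_of_le {a : ℕ} (h : a + 1 ≤ n + 1) : starZerosBefore n w (a + 1) = 0 := by
  induction a with
  | zero => simp [starZerosBefore]
  | succ a ih => rw [starZerosBefore_succ (by omega), ih (by omega), starBit_of_le (by omega)]; rfl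

theorem starZerosBefore_add (i : ℕ) :
    starZerosBefore n w (n + (i + 1)) = onesBefore n w (i + 1) := by
  induction i with
  | zero => rw [starZerosBefore_of_le le_rfl]; simp [onesBefore, Nat.count_succ, isOne]
  | succ i ih =>
    rw [← Nat.add_assoc, starZerosBefore_succ (by omega), ih, starBit_add (by omega)]
    rw [onesBefore, onesBefore, Nat.count_succ _ (i + 1)]
    cases isOne n w (i + 1) <;> simp

theorem range'_split {N a : ℕ} (h₁ : 1 ≤ a) (h₂ : a ≤ N) :
    List.range' 1 N = List.range' 1 (a - 1) ++ a :: List.range' (a + 1) (N - a) := by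
  obtain ⟨a, rfl⟩ : ∃ c, a = c + 1 := ⟨a - 1, by omega⟩
  obtain ⟨b, rfl⟩ : ∃ c, N = a + 1 + c := ⟨N - (a + 1), by omega⟩
  rw [show a + 1 + b - (a + 1) = b by omega, ← List.range'_succ, Nat.add_sub_cancel,
    show a + 1 + b = a + (b + 1) by omega]
  have := List.range'_append (s := 1) (m := a) (n := b + 1) (step := 1)
  rw [← this]
  congr 2
  omega

theorem length_filter_add_filter (p : ℕ → Bool) (l : List ℕ) :
    (l.filter fun i => !(p i)).length + (l.filter p).length = l.length := by
  induction l with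
  | nil => rfl
  | cons a l ih => cases h : p a <;> simp [h] <;> omega

theorem length_zeroPos_add_onePos :
    (zeroPos n w).length + (onePos n w).length = 2 * n + 1 := by
  rw [zeroPos, onePos, length_filter_add_filter]; simp

theorem length_bitonic : (bitonic n w).length = 2 * n + 1 := by
  simp [bitonic, length_zeroPos_add_onePos]

theorem mem_bitonic {a : ℕ} : a ∈ bitonic n w ↔ 1 ≤ a ∧ a ≤ 2 * n + 1 := by
  simp only [bitonic, zeroPos, onePos, List.mem_append, List.mem_reverse, List.mem_filter,
    List.mem_range'_1]
  cases starBit n w a <;> simp <;> omega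

theorem nodup_bitonic : (bitonic n w).Nodup := by
  rw [bitonic, List.nodup_append]
  refine ⟨List.Nodup.filter _ List.nodup_range',
    List.nodup_reverse.2 (List.Nodup.filter _ List.nodup_range'), ?_⟩
  intro a ha b hb hab
  simp only [zeroPos, onePos, List.mem_reverse, List.mem_filter] at ha hb
  rw [hab] at ha
  simp_all

theorem idxOf_bitonic_of_false {a : ℕ} (h₁ : 1 ≤ a) (h₂ : a ≤ 2 * n + 1)
    (h : starBit n w a = false) : (bitonic n w).idxOf a = starZerosBefore n w a := by
  have hz : zeroPos n w = ((List.range' 1 (a - 1)).filter fun i => !(starBit n w i)) ++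
      a :: (List.range' (a + 1) (2 * n + 1 - a)).filter fun i => !(starBit n w i) := by
    rw [zeroPos, range'_split h₁ h₂, List.filter_append, List.filter_cons_of_pos (by simp [h])]
  rw [bitonic, hz, List.append_assoc, List.idxOf_append_of_notMem, List.cons_append,
    List.idxOf_cons_self]
  · rfl
  · simp only [List.mem_filter, List.mem_range'_1]; omega

/-- In `π^b` the entry `a` is preceded by all of `X` and by the elements of `Y` beyond `a`; the
latter are counted through their complement. The additive form avoids truncated subtraction. -/
theorem idxOf_bitonic_of_true {a : ℕ} (h₁ : 1 ≤ a) (h₂ : a ≤ 2 * n + 1)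
    (h : starBit n w a = true) :
    (bitonic n w).idxOf a + (a - 1) = 2 * n + starZerosBefore n w a := by
  have hz : onePos n w = ((List.range' 1 (a - 1)).filter fun i => starBit n w i) ++
      a :: (List.range' (a + 1) (2 * n + 1 - a)).filter fun i => starBit n w i := by
    rw [onePos, range'_split h₁ h₂, List.filter_append, List.filter_cons_of_pos (by simp [h])]
  have hlen := length_zeroPos_add_onePos (n := n) (w := w)
  have hsum := length_filter_add_filter (fun i => starBit n w i) (List.range' 1 (a - 1))
  rw [List.length_range'] at hsum
  rw [hz, List.length_append, List.length_cons] at hlen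
  rw [bitonic, List.idxOf_append_of_notMem, hz, List.reverse_append, List.reverse_cons,
    List.append_assoc, List.idxOf_append_of_notMem, List.singleton_append, List.idxOf_cons_self,
    List.length_reverse, starZerosBefore]
  · omega
  · simp only [List.mem_reverse, List.mem_filter, List.mem_range'_1]; omega
  · simp [zeroPos, h]

/-- Entries of `π^b` whose indices, counted from 0, add up to `2n` are partners. The default value
of `getD` is never reached. -/
theorem sip_eq {a a' : ℕ} (h₁ : 1 ≤ a') (h₂ : a' ≤ 2 * n + 1)
    (h : (bitonic n w).idxOf a + (bitonic n w).idxOf a' = 2 * n) : sip n w a = a' := by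
  rw [sip, show 2 * n - (bitonic n w).idxOf a = (bitonic n w).idxOf a' by omega]
  have hlt := List.idxOf_lt_length_of_mem (mem_bitonic (n := n) (w := w).2 ⟨h₁, h₂⟩)
  rw [List.getD_eq_getElem _ _ hlt, List.getElem_idxOf]

theorem sip_injOn {p p' : ℕ} (hp : p ∈ Finset.Icc 1 (2 * n + 1))
    (hp' : p' ∈ Finset.Icc 1 (2 * n + 1)) (h : sip n w p = sip n w p') : p = p' := by
  rw [Finset.mem_Icc, ← mem_bitonic (w := w)] at hp hp'
  have h₁ := List.idxOf_lt_length_of_mem hp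
  have h₂ := List.idxOf_lt_length_of_mem hp'
  have hl := length_bitonic (n := n) (w := w)
  rw [sip, sip, List.getD_eq_getElem _ _ (by omega), List.getD_eq_getElem _ _ (by omega),
    nodup_bitonic.getElem_inj_iff] at h
  rw [← List.idxOf_inj hp]
  omega

theorem idxOf_add_of_one {i : ℕ} (h : isOne n w i = true) :
    (bitonic n w).idxOf (n + i) = onesBefore n w i := by
  obtain ⟨h₁, h₂, -⟩ := isOne_iff.1 h
  rw [idxOf_bitonic_of_false (by omega) (by omega) (by rw [starBit_add h₁, h]; rfl)]
  obtain ⟨i, rfl⟩ : ∃ c, i = c + 1 := ⟨i - 1, by omega⟩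
  exact starZerosBefore_add i

theorem idxOf_add_of_zero {i : ℕ} (h : IsZero n w i) (hi : i ≤ n + 1) :
    (bitonic n w).idxOf (n + i) + zerosBefore n w i = n := by
  have h₁ := h.1
  obtain ⟨i, rfl⟩ : ∃ c, i = c + 1 := ⟨i - 1, by omega⟩
  have h₂ := idxOf_bitonic_of_true (n := n) (w := w) (a := n + (i + 1)) (by omega) (by omega)
    (by rw [starBit_add h₁, h.2]; rfl)
  have h₃ := onesBefore_add_zerosBefore (n := n) (w := w) i
  rw [starZerosBefore_add] at h₂
  omega

theorem idxOf_of_le {v : ℕ} (h₁ : 1 ≤ v) (h₂ : v ≤ n) :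
    (bitonic n w).idxOf v + v = 2 * n + 1 := by
  have h := idxOf_bitonic_of_true (n := n) (w := w) (a := v) h₁ (by omega) (starBit_of_le h₂)
  obtain ⟨v, rfl⟩ : ∃ c, v = c + 1 := ⟨v - 1, by omega⟩
  rw [starZerosBefore_of_le (by omega)] at h
  omega

theorem onesBefore_lt {i : ℕ} (h : isOne n w i = true) : onesBefore n w i < i := by
  obtain ⟨h₁, -⟩ := isOne_iff.1 h
  obtain ⟨i, rfl⟩ : ∃ c, i = c + 1 := ⟨i - 1, by omega⟩
  have := onesBefore_add_zerosBefore (n := n) (w := w) i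
  omega

theorem sip_add_of_one {i : ℕ} (h : isOne n w i = true) :
    sip n w (n + i) = onesBefore n w i + 1 := by
  obtain ⟨h₁, h₂, -⟩ := isOne_iff.1 h
  have h₃ := onesBefore_lt h
  have h₄ := idxOf_of_le (n := n) (w := w) (v := onesBefore n w i + 1) (by omega) (by omega)
  exact sip_eq (by omega) (by omega) (by rw [idxOf_add_of_one h]; omega)

theorem sip_onesBefore {i : ℕ} (h : isOne n w i = true) :
    sip n w (onesBefore n w i + 1) = n + i := by
  obtain ⟨h₁, h₂, -⟩ := isOne_iff.1 h
  have h₃ := onesBefore_lt h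
  have h₄ := idxOf_of_le (n := n) (w := w) (v := onesBefore n w i + 1) (by omega) (by omega)
  exact sip_eq (by omega) (by omega) (by rw [idxOf_add_of_one h]; omega)

theorem sip_add_of_zero {i : ℕ} (h : IsZero n w i) (hi : i ≤ n + 1)
    (hz : 1 ≤ zerosBefore n w i) : sip n w (n + i) = n + 1 - zerosBefore n w i := by
  have h₁ := idxOf_add_of_zero h hi
  by_cases h₀ : zerosBefore n w i ≤ n
  · have h₂ := h.1
    have h₄ := idxOf_of_le (n := n) (w := w) (v := n + 1 - zerosBefore n w i) (by omega)
      (by omega)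
    exact sip_eq (by omega) (by omega) (by omega)
  · omega

theorem sip_zerosBefore {i : ℕ} (h : IsZero n w i) (hi : i ≤ n + 1)
    (hz : 1 ≤ zerosBefore n w i) : sip n w (n + 1 - zerosBefore n w i) = n + i := by
  have h₁ := idxOf_add_of_zero h hi
  have h₂ := h.1
  have h₄ := idxOf_of_le (n := n) (w := w) (v := n + 1 - zerosBefore n w i) (by omega) (by omega)
  exact sip_eq (by omega) (by omega) (by omega)

/-- The first zero is the middle entry of `π^b`, with index `n`. -/
theorem sip_first_zero {i : ℕ} (h : IsZero n w i) (hi : i ≤ n + 1)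
    (hz : zerosBefore n w i = 0) : sip n w (n + i) = n + i := by
  have h₁ := idxOf_add_of_zero h hi
  have h₂ := h.1
  exact sip_eq (by omega) (by omega) (by omega)

end Permutation

theorem exists_of_lt_count {p : ℕ → Prop} [DecidablePred p] {m : ℕ} :
    ∀ {j : ℕ}, m < Nat.count p j → ∃ i < j, p i ∧ Nat.count p i = m
  | 0, h => by simp at h
  | j + 1, h => by
    rw [Nat.count_succ] at h
    by_cases hm : m < Nat.count p j
    · obtain ⟨i, h₁, h₂⟩ := exists_of_lt_count hm
      exact ⟨i, by omega, h₂⟩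
    · split_ifs at h with hp
      · exact ⟨j, by omega, hp, by omega⟩
      · omega

theorem IsDmax.unique {N : ℕ} {π : ℕ → ℕ} {i m m' : ℕ}
    (hπ : ∀ p ∈ Finset.Icc 1 N, ∀ p' ∈ Finset.Icc 1 N, π p = π p' → p = p')
    (h : IsDmax N π i m) (h' : IsDmax N π i m') : m = m' := by
  obtain ⟨p, hp, hpi, h⟩ := h
  obtain ⟨p', hp', hpi', h'⟩ := h'
  obtain rfl := hπ p hp p' hp' (hpi.trans hpi'.symm)
  rcases h with ⟨j, hj, hij, hk, rfl⟩ | ⟨hk, rfl⟩ <;>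
    rcases h' with ⟨j', hj', hij', hk', rfl⟩ | ⟨hk', rfl⟩
  · rcases lt_trichotomy j j' with h | rfl | h
    · have := hk j' (Finset.mem_Ioo.2 ⟨h, (Finset.mem_Ico.1 hj').2⟩); omega
    · rfl
    · have := hk' j (Finset.mem_Ioo.2 ⟨h, (Finset.mem_Ico.1 hj).2⟩); omega
  · have := hk' j hj; omega
  · have := hk j' hj'; omega
  · rfl

/-! ### The back edges -/

section Dmax

variable {n w : ℕ}

theorem isZero_of_lt {i : ℕ} (h : n < i) : IsZero n w i := by
  refine ⟨by omega, ?_⟩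
  simp [isOne, show ¬ i ≤ n by omega]

theorem isZero_or_isOne {i : ℕ} (h : 1 ≤ i) : IsZero n w i ∨ isOne n w i = true := by
  cases hi : isOne n w i
  · exact Or.inl ⟨h, hi⟩
  · exact Or.inr rfl

/-- The position of the `(m+1)`-st zero. -/
noncomputable def zeroAt (n w m : ℕ) : ℕ := Nat.nth (IsZero n w) m

/-- Only the zeros up to `n + 1` have a meaning for the permutation; the ones beyond make `zeroAt`
total. -/
theorem infinite_isZero : (Set.ofPred (IsZero n w)).Infinite :=
  Set.infinite_of_not_bddAbove fun ⟨b, hb⟩ => by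
    have := hb (show IsZero n w (n + b + 1) from isZero_of_lt (by omega))
    omega

theorem isZero_zeroAt (m : ℕ) : IsZero n w (zeroAt n w m) :=
  Nat.nth_mem_of_infinite infinite_isZero m

theorem zerosBefore_zeroAt (m : ℕ) : zerosBefore n w (zeroAt n w m) = m :=
  Nat.count_nth_of_infinite infinite_isZero m

theorem zeroAt_strictMono : StrictMono (zeroAt n w) := Nat.nth_strictMono infinite_isZero

theorem zeroAt_zerosBefore {i : ℕ} (h : IsZero n w i) : zeroAt n w (zerosBefore n w i) = i :=
  Nat.nth_count h

theorem zerosBefore_lt_of_lt {i j : ℕ} (h : IsZero n w i) (hij : i < j) :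
    zerosBefore n w i < zerosBefore n w j := by
  have := zerosBefore_mono (n := n) (w := w) (show i + 1 ≤ j from hij)
  rw [zerosBefore_succ_of_zero h] at this
  omega

/-- The inequality on the right is not strict because `n + 1` is itself a zero. -/
theorem zeroAt_le_iff {m : ℕ} : zeroAt n w m ≤ n + 1 ↔ m ≤ zerosBefore n w (n + 1) := by
  constructor
  · intro h
    rw [← zerosBefore_zeroAt (n := n) (w := w) m]
    exact zerosBefore_mono h
  · intro h
    by_contra hlt
    have := zerosBefore_lt_of_lt (isZero_of_lt (w := w) (show n < n + 1 by omega)) (not_le.1 hlt)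
    rw [zerosBefore_zeroAt] at this
    omega

theorem isOne_of_lt_zeroAt {m i : ℕ} (h₁ : 1 ≤ i) (h : i < zeroAt n w m)
    (hm : m ≤ zerosBefore n w i) : isOne n w i = true := by
  rcases isZero_or_isOne h₁ with hi | hi
  · have := zerosBefore_lt_of_lt hi h
    rw [zerosBefore_zeroAt] at this
    omega
  · exact hi

theorem onesBefore_lt_of_lt {i j : ℕ} (h : isOne n w i = true) (hij : i < j) :
    onesBefore n w i < onesBefore n w j := by
  have := onesBefore_mono (n := n) (w := w) (show i + 1 ≤ j from hij)
  rw [onesBefore_succ_of_one h] at this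
  omega

theorem sip_mem (p : ℕ) :
    1 ≤ sip n w p ∧ sip n w p ≤ 2 * n + 1 := by
  rw [← mem_bitonic (w := w), sip, List.getD_eq_getElem]
  · exact List.getElem_mem _
  · rw [length_bitonic]; omega

theorem exists_one_of_le {v : ℕ} (h₁ : 1 ≤ v) (h₂ : v ≤ onesBefore n w (n + 1)) :
    ∃ i ≤ n, isOne n w i = true ∧ onesBefore n w i + 1 = v := by
  obtain ⟨i, hi, hone, hc⟩ := exists_of_lt_count (m := v - 1) (j := n + 1)
    (p := fun j => isOne n w j = true) (by rw [onesBefore] at h₂; omega)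
  exact ⟨i, by omega, hone, by rw [onesBefore, hc]; omega⟩

theorem sip_eq_of_one_le_zeros (h : 1 ≤ zerosBefore n w (n + 1)) :
    sip n w n = n + zeroAt n w 1 := by
  have := sip_zerosBefore (isZero_zeroAt (n := n) (w := w) 1) (zeroAt_le_iff.2 h)
    (by rw [zerosBefore_zeroAt])
  rwa [zerosBefore_zeroAt] at this

theorem isOne_of_zerosBefore_eq_zero {i j : ℕ} (h : zerosBefore n w j = 0) (h₁ : 1 ≤ i)
    (hij : i < j) : isOne n w i = true := by
  rcases isZero_or_isOne (n := n) (w := w) h₁ with hi | hi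
  · have := zerosBefore_lt_of_lt hi hij
    omega
  · exact hi

theorem sip_lt_of_le_onesBefore {p i : ℕ} (h₁ : 1 ≤ p) (h : p ≤ onesBefore n w i) :
    sip n w p < n + i := by
  obtain ⟨j, hj, hone, hc⟩ := exists_of_lt_count (m := p - 1) (j := i)
    (p := fun j => isOne n w j = true) (by rw [onesBefore] at h; omega)
  have h₂ : onesBefore n w j + 1 = p := by rw [onesBefore, hc]; omega
  rw [← h₂, sip_onesBefore hone]
  omega

/-- `π*` starts with the ones in increasing order, so nothing to the left of a one exceeds it. -/
theorem isDmax_of_one {i : ℕ} (h : isOne n w i = true) :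
    IsDmax (2 * n + 1) (sip n w) (n + i) (2 * n + 2) := by
  have h₁ := isOne_iff.1 h
  have h₂ := onesBefore_lt h
  refine ⟨onesBefore n w i + 1, Finset.mem_Icc.2 (by omega), sip_onesBefore h, Or.inr ⟨?_, rfl⟩⟩
  intro k hk
  rw [Finset.mem_Ico] at hk
  exact sip_lt_of_le_onesBefore hk.1 (by omega)

/-- The zeros after the first stand in decreasing order up to position `n`, so the left neighbour of
such a zero is the next zero. The first zero is a fixed point: back to position `n`, which holds the
second zero, only small entries precede it. -/
theorem isDmax_of_zero {i : ℕ} (h : IsZero n w i) (hi : i ≤ n) :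
    IsDmax (2 * n + 1) (sip n w) (n + i) (n + zeroAt n w (zerosBefore n w i + 1)) := by
  have h₁ := h.1
  have h₂ := idxOf_add_of_zero h (by omega)
  have h₃ := zerosBefore_lt_of_lt h (show i < n + 1 by omega)
  have h₄ := zeroAt_le_iff.2 (show zerosBefore n w i + 1 ≤ zerosBefore n w (n + 1) by omega)
  have h₅ := zeroAt_strictMono (n := n) (w := w) (Nat.lt_succ_self (zerosBefore n w i))
  rw [zeroAt_zerosBefore h, Nat.succ_eq_add_one] at h₅
  have h₆ := onesBefore_add_zerosBefore (n := n) (w := w) n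
  by_cases h₀ : zerosBefore n w i = 0
  · refine ⟨n + i, Finset.mem_Icc.2 (by omega), sip_first_zero h (by omega) h₀, Or.inl ⟨n,
      Finset.mem_Ico.2 (by omega), ?_, ?_, ?_⟩⟩
    · rw [sip_eq_of_one_le_zeros (by omega), ← zero_add 1, ← h₀]; omega
    · intro k hk
      rw [Finset.mem_Ioo] at hk
      obtain ⟨t, rfl⟩ : ∃ t, k = n + t := ⟨k - n, by omega⟩
      have h₇ := isOne_of_zerosBefore_eq_zero h₀ (show 1 ≤ t by omega) (by omega)
      rw [sip_add_of_one h₇]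
      have := onesBefore_lt h₇
      omega
    · rw [sip_eq_of_one_le_zeros (by omega), h₀]
  · have h₇ := sip_zerosBefore (isZero_zeroAt (n := n) (w := w) (zerosBefore n w i + 1)) h₄
      (by rw [zerosBefore_zeroAt]; omega)
    rw [zerosBefore_zeroAt] at h₇
    refine ⟨n + 1 - zerosBefore n w i, Finset.mem_Icc.2 (by omega),
      sip_zerosBefore h (by omega) (by omega), Or.inl ⟨n + 1 - (zerosBefore n w i + 1),
      Finset.mem_Ico.2 (by omega), by omega, ?_, h₇.symm⟩⟩
    intro k hk
    rw [Finset.mem_Ioo] at hk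
    omega

theorem isDmax_last : IsDmax (2 * n + 1) (sip n w) (2 * n + 1) (2 * n + 2) := by
  have hz : IsZero n w (n + 1) := isZero_of_lt (by omega)
  have h₆ := onesBefore_add_zerosBefore (n := n) (w := w) n
  have h₇ : ∀ p, 1 ≤ p → p ≤ onesBefore n w (n + 1) → sip n w p < 2 * n + 1 := by
    intro p hp h
    have := sip_lt_of_le_onesBefore hp h
    omega
  by_cases h₀ : zerosBefore n w (n + 1) = 0
  · refine ⟨2 * n + 1, Finset.mem_Icc.2 (by omega), ?_, Or.inr ⟨?_, rfl⟩⟩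
    · rw [show 2 * n + 1 = n + (n + 1) by omega]
      exact sip_first_zero hz le_rfl h₀
    · intro k hk
      rw [Finset.mem_Ico] at hk
      by_cases hkn : k ≤ n
      · exact h₇ k hk.1 (by omega)
      · obtain ⟨t, rfl⟩ : ∃ t, k = n + t := ⟨k - n, by omega⟩
        have h₈ := isOne_of_zerosBefore_eq_zero h₀ (show 1 ≤ t by omega) (by omega)
        rw [sip_add_of_one h₈]
        have := onesBefore_lt h₈
        omega
  · refine ⟨n + 1 - zerosBefore n w (n + 1), Finset.mem_Icc.2 (by omega), ?_, Or.inr ⟨?_, rfl⟩⟩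
    · rw [sip_zerosBefore hz le_rfl (by omega)]; omega
    · intro k hk
      rw [Finset.mem_Ico] at hk
      exact h₇ k hk.1 (by omega)

/-- `v ≤ n` is located in `π*` at the position `n + i`, and `M` zeros precede `i`. -/
def IsLocated (n w v M i : ℕ) : Prop :=
  1 ≤ i ∧ i ≤ n + 1 ∧ sip n w (n + i) = v ∧ zerosBefore n w i = M ∧ onesBefore n w i < v ∧
    v + M ≤ n + 1

/-- Either `b_i` is the `v`-th one and `M` zeros precede it, or there are fewer than `v` ones and
`M = n + 1 - v`. -/
def IsLevel (n w v M : ℕ) : Prop :=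
  (∃ i ≤ n, isOne n w i = true ∧ onesBefore n w i + 1 = v ∧ zerosBefore n w i = M) ∨
    (onesBefore n w (n + 1) < v ∧ v ≤ n ∧ v + M = n + 1)

theorem exists_isLevel {v : ℕ} (h₁ : 1 ≤ v) (h₂ : v ≤ n) : ∃ M, IsLevel n w v M := by
  by_cases h : v ≤ onesBefore n w (n + 1)
  · obtain ⟨i, h₃, h₄, h₅⟩ := exists_one_of_le h₁ h
    exact ⟨_, Or.inl ⟨i, h₃, h₄, h₅, rfl⟩⟩
  · exact ⟨n + 1 - v, Or.inr (by omega)⟩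

theorem IsLevel.exists_isLocated {v M : ℕ} (h : IsLevel n w v M) :
    ∃ i, IsLocated n w v M i := by
  rcases h with ⟨i, hin, hi, hv, hM⟩ | ⟨h₁, h₂, h₃⟩
  · have h₁ := (isOne_iff.1 hi).1
    obtain ⟨i, rfl⟩ : ∃ c, i = c + 1 := ⟨i - 1, by omega⟩
    have := onesBefore_add_zerosBefore (n := n) (w := w) i
    exact ⟨i + 1, h₁, by omega, by rw [sip_add_of_one hi, hv], hM, by omega, by omega⟩
  · have h₆ := onesBefore_add_zerosBefore (n := n) (w := w) n
    have h₄ := zeroAt_le_iff.2 (show M ≤ zerosBefore n w (n + 1) by omega)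
    have h₅ := isZero_zeroAt (n := n) (w := w) M
    have h₈ := zerosBefore_zeroAt (n := n) (w := w) M
    have h₇ := sip_add_of_zero h₅ h₄ (by omega)
    have h₉ := onesBefore_mono (n := n) (w := w) h₄
    exact ⟨_, h₅.1, h₄, by omega, h₈, by omega, by omega⟩

theorem IsLocated.sip_lt {v M i t : ℕ} (h : IsLocated n w v M i) (ht : isOne n w t = true)
    (hti : t < i) : sip n w (n + t) < v := by
  rw [sip_add_of_one ht]
  have := onesBefore_lt_of_lt ht hti
  have := h.2.2.2.2.1
  omega

/-- Between the last zero before `i` and `i` there are only ones, and their entries are ranks below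
`v`. -/
theorem IsLocated.isDmax_zeroAt {v M i : ℕ} (h : IsLocated n w v (M + 1) i)
    (h₂ : v < sip n w (n + zeroAt n w M)) :
    IsDmax (2 * n + 1) (sip n w) v (sip n w (n + zeroAt n w M)) := by
  have h₃ := (isZero_zeroAt (n := n) (w := w) M).1
  have h₄ : zeroAt n w M < i := by
    by_contra hle
    have := zerosBefore_mono (n := n) (w := w) (not_lt.1 hle)
    rw [h.2.2.2.1, zerosBefore_zeroAt] at this
    omega
  have hi := h.2.1
  refine ⟨n + i, Finset.mem_Icc.2 (by omega), h.2.2.1, Or.inl ⟨n + zeroAt n w M,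
    Finset.mem_Ico.2 (by omega), h₂, ?_, rfl⟩⟩
  intro k hk
  rw [Finset.mem_Ioo] at hk
  obtain ⟨t, rfl⟩ : ∃ t, k = n + t := ⟨k - n, by omega⟩
  refine h.sip_lt ?_ (by omega)
  rcases isZero_or_isOne (n := n) (w := w) (show 1 ≤ t by omega) with ht | ht
  · have h₅ := zerosBefore_lt_of_lt ht (show t < i by omega)
    have h₆ := zerosBefore_lt_of_lt (isZero_zeroAt (n := n) (w := w) M)
      (show zeroAt n w M < t by omega)
    rw [h.2.2.2.1] at h₅
    rw [zerosBefore_zeroAt] at h₆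
    omega
  · exact ht

theorem IsLevel.le {v M : ℕ} (h : IsLevel n w v M) : 1 ≤ v ∧ v ≤ n ∧
    M ≤ zerosBefore n w (n + 1) := by
  have h₆ := onesBefore_add_zerosBefore (n := n) (w := w) n
  rcases h with ⟨i, hin, hi, hv, rfl⟩ | ⟨h₁, h₂, h₃⟩
  · have := onesBefore_lt hi
    exact ⟨by omega, by omega, zerosBefore_mono (by omega)⟩
  · omega

theorem isDmax_of_level_two_le {v M : ℕ} (h : IsLevel n w v (M + 2)) :
    IsDmax (2 * n + 1) (sip n w) v (n - M) := by
  obtain ⟨h₁, h₂, h₃⟩ := h.le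
  obtain ⟨i, hi⟩ := h.exists_isLocated
  have h₄ := zeroAt_le_iff.2 (show M + 1 ≤ zerosBefore n w (n + 1) by omega)
  have h₅ := sip_add_of_zero (isZero_zeroAt (n := n) (w := w) (M + 1)) h₄
    (by rw [zerosBefore_zeroAt]; omega)
  rw [zerosBefore_zeroAt] at h₅
  have h₆ := hi.2.2.2.2.2
  have := hi.isDmax_zeroAt (by omega)
  rwa [h₅, show n + 1 - (M + 1) = n - M by omega] at this

theorem isDmax_of_level_one {v : ℕ} (h : IsLevel n w v 1) :
    IsDmax (2 * n + 1) (sip n w) v (n + zeroAt n w 0) := by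
  obtain ⟨h₁, h₂, h₃⟩ := h.le
  obtain ⟨i, hi⟩ := h.exists_isLocated
  have h₀ := isZero_zeroAt (n := n) (w := w) 0
  have h₄ := zeroAt_le_iff.2 (show 0 ≤ zerosBefore n w (n + 1) by omega)
  have h₅ := sip_first_zero h₀ h₄ (zerosBefore_zeroAt 0)
  have h₆ := h₀.1
  have := hi.isDmax_zeroAt (by omega)
  rwa [h₅] at this

/-- With no zero before `i`, all entries back to position `n` are ranks below `v`, so the search
ends at position `n`. -/
theorem IsLocated.isDmax_sip {v i : ℕ} (h : IsLocated n w v 0 i) (h₁ : 1 ≤ v) (h₂ : v ≤ n)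
    (h₃ : v < sip n w n) : IsDmax (2 * n + 1) (sip n w) v (sip n w n) := by
  have h₄ := h.1
  have h₅ := h.2.1
  refine ⟨n + i, Finset.mem_Icc.2 (by omega), h.2.2.1, Or.inl ⟨n,
    Finset.mem_Ico.2 (by omega), h₃, ?_, rfl⟩⟩
  intro k hk
  rw [Finset.mem_Ioo] at hk
  obtain ⟨t, rfl⟩ : ∃ t, k = n + t := ⟨k - n, by omega⟩
  exact h.sip_lt (isOne_of_zerosBefore_eq_zero h.2.2.2.1 (by omega) (by omega)) (by omega)

theorem isDmax_of_level_zero {v : ℕ} (h : IsLevel n w v 0) (hz : 1 ≤ zerosBefore n w (n + 1)) :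
    IsDmax (2 * n + 1) (sip n w) v (n + zeroAt n w 1) := by
  obtain ⟨h₁, h₂, h₃⟩ := h.le
  obtain ⟨i, hi⟩ := h.exists_isLocated
  have h₅ := sip_eq_of_one_le_zeros hz
  have := hi.isDmax_sip h₁ h₂ (by have := (isZero_zeroAt (n := n) (w := w) 1).1; omega)
  rwa [h₅] at this

/-- In the all-ones word, position `n` holds the `n`-th one, `2n`, instead of a second zero. -/
theorem isDmax_of_no_zero {v : ℕ} (h₁ : 1 ≤ v) (h₂ : v ≤ n) (hz : zerosBefore n w (n + 1) = 0) :
    IsDmax (2 * n + 1) (sip n w) v (2 * n) := by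
  obtain ⟨M, h⟩ := exists_isLevel (w := w) h₁ h₂
  obtain rfl : M = 0 := by have := h.le; omega
  obtain ⟨i, hi⟩ := h.exists_isLocated
  have h₃ := isOne_of_zerosBefore_eq_zero hz (show 1 ≤ n by omega) n.lt_succ_self
  have h₄ := sip_onesBefore h₃
  have h₅ := onesBefore_succ_of_one h₃
  have h₆ := onesBefore_add_zerosBefore (n := n) (w := w) n
  rw [show onesBefore n w n + 1 = n by omega] at h₄
  have := hi.isDmax_sip h₁ h₂ (by omega)
  rwa [h₄, ← two_mul] at this

theorem exists_isDmax {i : ℕ} (hi : i ∈ Finset.Icc 1 (2 * n + 1)) :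
    ∃ m, IsDmax (2 * n + 1) (sip n w) i m := by
  rw [Finset.mem_Icc] at hi
  by_cases hin : i ≤ n
  · by_cases hz : zerosBefore n w (n + 1) = 0
    · exact ⟨_, isDmax_of_no_zero hi.1 hin hz⟩
    · obtain ⟨M, h⟩ := exists_isLevel (w := w) hi.1 hin
      match M, h with
      | 0, h => exact ⟨_, isDmax_of_level_zero h (by omega)⟩
      | 1, h => exact ⟨_, isDmax_of_level_one h⟩
      | M + 2, h => exact ⟨_, isDmax_of_level_two_le h⟩
  · by_cases hi' : i = 2 * n + 1
    · subst hi'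
      exact ⟨_, isDmax_last⟩
    · obtain ⟨t, rfl⟩ : ∃ t, i = n + t := ⟨i - n, by omega⟩
      rcases isZero_or_isOne (n := n) (w := w) (show 1 ≤ t by omega) with ht | ht
      · exact ⟨_, isDmax_of_zero ht (by omega)⟩
      · exact ⟨_, isDmax_of_one ht⟩

open Classical in
/-- The target of the back edge of the node `i` of the graph that encodes `w`. -/
noncomputable def backTarget (n w i : ℕ) : ℕ :=
  if h : ∃ m, IsDmax (2 * n + 1) (sip n w) i m then h.choose else 0

theorem backTarget_eq {i m : ℕ} (h : IsDmax (2 * n + 1) (sip n w) i m) : backTarget n w i = m := by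
  have hex : ∃ m, IsDmax (2 * n + 1) (sip n w) i m := ⟨m, h⟩
  rw [backTarget, dif_pos hex]
  exact hex.choose_spec.unique (fun _ hp _ hp' => sip_injOn hp hp') h

theorem isDmaxFun_backTarget : IsDmaxFun (2 * n + 1) (sip n w) (backTarget n w) := by
  have key : ∀ i ∈ Finset.Icc 1 (2 * n + 1),
      IsDmax (2 * n + 1) (sip n w) i (backTarget n w i) := by
    intro i hi
    obtain ⟨m, hm⟩ := exists_isDmax (w := w) hi
    rwa [backTarget_eq hm]
  refine ⟨fun i m => ⟨fun h => ⟨?_, (backTarget_eq h).symm⟩, fun h => h.2 ▸ key i h.1⟩, ?_, ?_⟩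
  · obtain ⟨p, hp, rfl, -⟩ := h
    rw [Finset.mem_Icc] at hp ⊢
    exact sip_mem p
  · intro i hi
    obtain ⟨p, hp, rfl, ⟨j, hj, hij, -, h⟩ | ⟨-, h⟩⟩ := key i hi
    · omega
    · rw [Finset.mem_Icc] at hi; omega
  · intro i hi
    obtain ⟨p, hp, rfl, ⟨j, hj, hij, -, h⟩ | ⟨-, h⟩⟩ := key i hi
    · rw [Finset.mem_Icc] at hp
      rw [Finset.mem_Ico] at hj
      have := sip_mem (n := n) (w := w) j
      omega
    · omega

/-- The number of nodes whose back edges differ in the graphs that encode `w` and `w'`. -/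
noncomputable def graphDist (n w w' : ℕ) : ℕ :=
  (diffNodes (2 * n + 1) (backTarget n w) (backTarget n w')).card

theorem graphDist_comm (n w w' : ℕ) : graphDist n w w' = graphDist n w' w := by
  rw [graphDist, diffNodes_comm, graphDist]

theorem isMinVM_of_graphDist {m : ℕ} (h₁ : ∃ w', InRange n w' ∧ w' ≠ w ∧ graphDist n w w' = m)
    (h₂ : ∀ w', InRange n w' → w' ≠ w → m ≤ graphDist n w w') : IsMinVM n w m := by
  constructor
  · obtain ⟨w', hr, hne, rfl⟩ := h₁
    exact ⟨w', hr, hne, modifiedIn_permGraph isDmaxFun_backTarget isDmaxFun_backTarget⟩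
  · rintro k ⟨w', hr, hne, hk⟩
    exact (h₂ w' hr hne).trans
      (le_of_modifiedIn_permGraph isDmaxFun_backTarget isDmaxFun_backTarget hk)

end Dmax

/-! ### Targets of the back edges, in general and for words with few zeros -/

section BackTargets

variable {n w : ℕ}

theorem zeroAt_lt_succ (m : ℕ) : zeroAt n w m < zeroAt n w (m + 1) :=
  zeroAt_strictMono (Nat.lt_succ_self m)

theorem zeroAt_zero_lt : zeroAt n w 0 < zeroAt n w 1 := zeroAt_lt_succ 0

theorem zeroAt_one_lt : zeroAt n w 1 < zeroAt n w 2 := zeroAt_lt_succ 1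

theorem zeroAt_succ_le {m : ℕ} (h : zeroAt n w m ≤ n) : zeroAt n w (m + 1) ≤ n + 1 := by
  have := zerosBefore_lt_of_lt (isZero_zeroAt m) (show zeroAt n w m < n + 1 by omega)
  rw [zerosBefore_zeroAt] at this
  exact zeroAt_le_iff.2 this

theorem zeroAt_one_le (h : zeroAt n w 0 ≤ n) : zeroAt n w 1 ≤ n + 1 := zeroAt_succ_le h

theorem zeroAt_two_le (h : zeroAt n w 1 ≤ n) : zeroAt n w 2 ≤ n + 1 := zeroAt_succ_le h

theorem zeroAt_zero_eq {z : ℕ} (h : IsZero n w z) (h' : ∀ i, 1 ≤ i → i < z → isOne n w i = true) :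
    zeroAt n w 0 = z := by
  have h₁ := isZero_zeroAt (n := n) (w := w) 0
  rcases lt_trichotomy (zeroAt n w 0) z with hlt | heq | hgt
  · have := h' _ h₁.1 hlt
    rw [h₁.2] at this
    exact absurd this (by decide)
  · exact heq
  · have := isOne_of_lt_zeroAt h.1 hgt (Nat.zero_le _)
    rw [h.2] at this
    exact absurd this (by decide)

theorem zeroAt_succ_eq {m z : ℕ} (h : IsZero n w z) (hz : zeroAt n w m < z)
    (h' : ∀ i, zeroAt n w m < i → i < z → isOne n w i = true) : zeroAt n w (m + 1) = z := by
  have h₁ := isZero_zeroAt (n := n) (w := w) (m + 1)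
  rcases lt_trichotomy (zeroAt n w (m + 1)) z with hlt | heq | hgt
  · have := h' _ (zeroAt_lt_succ m) hlt
    rw [h₁.2] at this
    exact absurd this (by decide)
  · exact heq
  · have h₂ := zerosBefore_lt_of_lt (isZero_zeroAt (n := n) (w := w) m) hz
    rw [zerosBefore_zeroAt] at h₂
    have := isOne_of_lt_zeroAt h.1 hgt h₂
    rw [h.2] at this
    exact absurd this (by decide)

theorem eq_zeroAt_of_isZero {i : ℕ} (h : IsZero n w i) :
    i = zeroAt n w 0 ∨ i = zeroAt n w 1 ∨ zeroAt n w 2 ≤ i := by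
  rw [← zeroAt_zerosBefore h]
  match hm : zerosBefore n w i with
  | 0 => exact Or.inl rfl
  | 1 => exact Or.inr (Or.inl rfl)
  | m + 2 => exact Or.inr (Or.inr (zeroAt_strictMono.monotone (by omega)))

theorem zerosBefore_of_le_zeroAt_zero {i : ℕ} (h : i ≤ zeroAt n w 0) :
    zerosBefore n w i = 0 := by
  have := zerosBefore_mono (n := n) (w := w) h
  rw [zerosBefore_zeroAt] at this
  omega

theorem zerosBefore_of_between {m i : ℕ} (h : zeroAt n w m < i) (h' : i ≤ zeroAt n w (m + 1)) :
    zerosBefore n w i = m + 1 := by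
  have h₁ := zerosBefore_mono (n := n) (w := w) h'
  have h₂ := zerosBefore_lt_of_lt (isZero_zeroAt m) h
  rw [zerosBefore_zeroAt] at h₁ h₂
  omega

theorem onesBefore_eq {i : ℕ} (h : 1 ≤ i) : onesBefore n w i + zerosBefore n w i + 1 = i := by
  obtain ⟨i, rfl⟩ : ∃ c, i = c + 1 := ⟨i - 1, by omega⟩
  rw [onesBefore_add_zerosBefore]

theorem backTarget_one {i : ℕ} (h : isOne n w i = true) : backTarget n w (n + i) = 2 * n + 2 :=
  backTarget_eq (isDmax_of_one h)

theorem backTarget_zeroAt {m : ℕ} (h : zeroAt n w m ≤ n) :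
    backTarget n w (n + zeroAt n w m) = n + zeroAt n w (m + 1) := by
  have := backTarget_eq (isDmax_of_zero (isZero_zeroAt m) h)
  rwa [zerosBefore_zeroAt] at this

theorem backTarget_first (h : zeroAt n w 0 ≤ n) :
    backTarget n w (n + zeroAt n w 0) = n + zeroAt n w 1 := backTarget_zeroAt h

theorem backTarget_second (h : zeroAt n w 1 ≤ n) :
    backTarget n w (n + zeroAt n w 1) = n + zeroAt n w 2 := backTarget_zeroAt h

theorem backTarget_last : backTarget n w (2 * n + 1) = 2 * n + 2 := backTarget_eq isDmax_last

theorem backTarget_upper {i : ℕ} (h₁ : 1 ≤ i) (h₂ : i ≤ n) :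
    (isOne n w i = true ∧ backTarget n w (n + i) = 2 * n + 2) ∨
      (IsZero n w i ∧ ∃ j, i < j ∧ j ≤ n + 1 ∧ IsZero n w j ∧ backTarget n w (n + i) = n + j) := by
  rcases isZero_or_isOne (n := n) (w := w) h₁ with h | h
  · right
    have h₃ := zeroAt_zerosBefore h
    refine ⟨h, zeroAt n w (zerosBefore n w i + 1), ?_, ?_, isZero_zeroAt _, ?_⟩
    · conv_lhs => rw [← h₃]
      exact zeroAt_lt_succ _
    · exact zeroAt_succ_le (by omega)
    · exact backTarget_eq (isDmax_of_zero h h₂)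
  · exact Or.inl ⟨h, backTarget_one h⟩

theorem one_le_zerosBefore (ha : zeroAt n w 0 ≤ n) : 1 ≤ zerosBefore n w (n + 1) := by
  have := zerosBefore_lt_of_lt (isZero_zeroAt (n := n) (w := w) 0)
    (show zeroAt n w 0 < n + 1 by omega)
  omega

theorem backTarget_of_lt {v : ℕ} (ha : zeroAt n w 0 ≤ n) (h₁ : 1 ≤ v) (h₂ : v < zeroAt n w 0) :
    backTarget n w v = n + zeroAt n w 1 := by
  have h₃ := zerosBefore_of_le_zeroAt_zero h₂.le
  have h₄ := onesBefore_eq (n := n) (w := w) h₁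
  exact backTarget_eq (isDmax_of_level_zero
    (Or.inl ⟨v, by omega, isOne_of_lt_zeroAt h₁ h₂ (Nat.zero_le _), by omega, h₃⟩)
    (one_le_zerosBefore ha))

theorem backTarget_of_between {v : ℕ} (ha : zeroAt n w 0 ≤ n) (h₁ : zeroAt n w 0 ≤ v)
    (h₂ : v + 1 < zeroAt n w 1) : backTarget n w v = n + zeroAt n w 0 := by
  have h₃ := zerosBefore_of_between (n := n) (w := w) (m := 0) (i := v + 1) (by omega) h₂.le
  have h₄ := onesBefore_add_zerosBefore (n := n) (w := w) v
  have h₅ := zeroAt_one_le ha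
  exact backTarget_eq (isDmax_of_level_one
    (Or.inl ⟨v + 1, by omega, isOne_of_lt_zeroAt (by omega) h₂ (by omega), by omega, h₃⟩))

theorem isLevel_of_le_zeros {m : ℕ} (h₁ : 1 ≤ m) (hm : zeroAt n w (m - 1) ≤ n) (hmn : m ≤ n) :
    IsLevel n w (n + 1 - m) m := by
  have h₄ := onesBefore_add_zerosBefore (n := n) (w := w) n
  have h₅ := zerosBefore_lt_of_lt (isZero_zeroAt (n := n) (w := w) (m - 1))
    (show zeroAt n w (m - 1) < n + 1 by omega)
  rw [zerosBefore_zeroAt] at h₅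
  exact Or.inr (by omega)

theorem backTarget_n (ha : zeroAt n w 0 ≤ n) : backTarget n w n = n + zeroAt n w 0 := by
  have := (isZero_zeroAt (n := n) (w := w) 0).1
  have := isLevel_of_le_zeros (n := n) (w := w) (m := 1) le_rfl ha (by omega)
  exact backTarget_eq (isDmax_of_level_one this)

theorem backTarget_n_sub_one (hb : zeroAt n w 1 ≤ n) : backTarget n w (n - 1) = n := by
  have := (isZero_zeroAt (n := n) (w := w) 0).1
  have := zeroAt_zero_lt (n := n) (w := w)
  have := isLevel_of_le_zeros (n := n) (w := w) (m := 2) (by omega) hb (by omega)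
  exact backTarget_eq (isDmax_of_level_two_le this)

theorem backTarget_n_sub_two (hc : zeroAt n w 2 ≤ n) : backTarget n w (n - 2) = n - 1 := by
  have := (isZero_zeroAt (n := n) (w := w) 0).1
  have := zeroAt_zero_lt (n := n) (w := w)
  have := zeroAt_one_lt (n := n) (w := w)
  have := isLevel_of_le_zeros (n := n) (w := w) (m := 3) (by omega) hc (by omega)
  exact backTarget_eq (isDmax_of_level_two_le this)

/-- A coarse description valid for every word with a zero; it is what the lower bounds need about an
arbitrary competitor. -/
theorem backTarget_lower {v : ℕ} (ha : zeroAt n w 0 ≤ n) (h₁ : 1 ≤ v) (h₂ : v ≤ n) :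
    (v < zeroAt n w 0 ∧ backTarget n w v = n + zeroAt n w 1) ∨
      (zeroAt n w 0 ≤ v ∧ (backTarget n w v = n + zeroAt n w 0 ∨ backTarget n w v ≤ n)) := by
  by_cases hv : v < zeroAt n w 0
  · exact Or.inl ⟨hv, backTarget_of_lt ha h₁ hv⟩
  · right
    refine ⟨not_lt.1 hv, ?_⟩
    obtain ⟨M, h⟩ := exists_isLevel (w := w) h₁ h₂
    match M, h with
    | 0, h =>
      -- With no zero before it, the `v`-th one would stand at position `v`, but `v` is not before
      -- the first zero.
      exfalso
      rcases h with ⟨i, h₃, h₄, h₅, h₆⟩ | h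
      · have h₇ := (isOne_iff.1 h₄).1
        have h₈ := onesBefore_eq (n := n) (w := w) h₇
        have h₉ : i = v := by omega
        subst h₉
        have h₁₀ := isZero_zeroAt (n := n) (w := w) 0
        rcases (not_lt.1 hv).eq_or_lt with h | h
        · rw [← h, h₁₀.2] at h₄
          exact absurd h₄ (by decide)
        · have := zerosBefore_lt_of_lt h₁₀ h
          omega
      · omega
    | 1, h => exact Or.inl (backTarget_eq (isDmax_of_level_one h))
    | M + 2, h => exact Or.inr (by rw [backTarget_eq (isDmax_of_level_two_le h)]; omega)

/-! ### Words with no zero, with one zero, and with two zeros of which the last is at the end -/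

theorem isOne_of_no_zero (h : n < zeroAt n w 0) {i : ℕ} (h₁ : 1 ≤ i) (h₂ : i ≤ n) :
    isOne n w i = true :=
  isOne_of_lt_zeroAt h₁ (by omega) (Nat.zero_le _)

theorem backTarget_no_zero_lower (h : n < zeroAt n w 0) {v : ℕ} (h₁ : 1 ≤ v) (h₂ : v ≤ n) :
    backTarget n w v = 2 * n :=
  backTarget_eq (isDmax_of_no_zero h₁ h₂ (zerosBefore_of_le_zeroAt_zero h))

theorem backTarget_no_zero_upper (h : n < zeroAt n w 0) {i : ℕ} (h₁ : 1 ≤ i) (h₂ : i ≤ n) :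
    backTarget n w (n + i) = 2 * n + 2 :=
  backTarget_one (isOne_of_no_zero h h₁ h₂)

/-- The only zero among `b_1 … b_n` is `b_z`. -/
def OneZero (n w z : ℕ) : Prop := z ≤ n ∧ zeroAt n w 0 = z ∧ zeroAt n w 1 = n + 1

/-- The only zeros among `b_1 … b_n` are `b_z` and `b_n`, and `z < n`. -/
def TwoZeros (n w z : ℕ) : Prop :=
  z < n ∧ zeroAt n w 0 = z ∧ zeroAt n w 1 = n ∧ zeroAt n w 2 = n + 1

theorem OneZero.lower {z : ℕ} (h : OneZero n w z) {v : ℕ} (h₁ : 1 ≤ v) (h₂ : v ≤ n) :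
    (v < z ∧ backTarget n w v = 2 * n + 1) ∨ (z ≤ v ∧ backTarget n w v = n + z) := by
  obtain ⟨hz, h₃, h₄⟩ := h
  subst h₃
  rcases lt_or_ge v (zeroAt n w 0) with hv | hv
  · exact Or.inl ⟨hv, by rw [backTarget_of_lt hz h₁ hv]; omega⟩
  · refine Or.inr ⟨hv, ?_⟩
    by_cases hn : v = n
    · rw [hn, backTarget_n hz]
    · rw [backTarget_of_between hz hv (by omega)]

theorem OneZero.upper {z : ℕ} (h : OneZero n w z) {i : ℕ} (h₁ : 1 ≤ i) (h₂ : i ≤ n) :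
    (i = z ∧ backTarget n w (n + i) = 2 * n + 1) ∨
      (i ≠ z ∧ backTarget n w (n + i) = 2 * n + 2) := by
  obtain ⟨hz, h₃, h₄⟩ := h
  subst h₃
  by_cases hi : i = zeroAt n w 0
  · exact Or.inl ⟨hi, by rw [hi, backTarget_first hz]; omega⟩
  · refine Or.inr ⟨hi, ?_⟩
    rcases isZero_or_isOne (n := n) (w := w) h₁ with h | h
    · have := eq_zeroAt_of_isZero h
      have := zeroAt_one_lt (n := n) (w := w)
      omega
    · exact backTarget_one h

theorem TwoZeros.lower {z : ℕ} (h : TwoZeros n w z) {v : ℕ} (h₁ : 1 ≤ v) (h₂ : v ≤ n) :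
    (v < z ∧ backTarget n w v = 2 * n) ∨ (z ≤ v ∧ v + 1 ≠ n ∧ backTarget n w v = n + z) ∨
      (v + 1 = n ∧ backTarget n w v = n) := by
  obtain ⟨hz, h₃, h₄, h₅⟩ := h
  subst h₃
  rcases lt_or_ge v (zeroAt n w 0) with hv | hv
  · exact Or.inl ⟨hv, by rw [backTarget_of_lt hz.le h₁ hv]; omega⟩
  · right
    by_cases hn : v = n
    · exact Or.inl ⟨hv, by omega, by rw [hn, backTarget_n hz.le]⟩
    by_cases hn' : v + 1 = n
    · right
      obtain rfl : v = n - 1 := by omega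
      exact ⟨hn', backTarget_n_sub_one h₄.le⟩
    · exact Or.inl ⟨hv, hn', backTarget_of_between hz.le hv (by omega)⟩

theorem TwoZeros.upper {z : ℕ} (h : TwoZeros n w z) {i : ℕ} (h₁ : 1 ≤ i) (h₂ : i ≤ n) :
    (i = z ∧ backTarget n w (n + i) = 2 * n) ∨ (i = n ∧ backTarget n w (n + i) = 2 * n + 1) ∨
      (i ≠ z ∧ i ≠ n ∧ backTarget n w (n + i) = 2 * n + 2) := by
  obtain ⟨hz, h₃, h₄, h₅⟩ := h
  subst h₃
  by_cases hi : i = zeroAt n w 0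
  · exact Or.inl ⟨hi, by rw [hi, backTarget_first hz.le]; omega⟩
  right
  by_cases hn : i = zeroAt n w 1
  · exact Or.inl ⟨by omega, by rw [hn, backTarget_second h₄.le]; omega⟩
  · refine Or.inr ⟨hi, by omega, ?_⟩
    rcases isZero_or_isOne (n := n) (w := w) h₁ with h | h
    · have := eq_zeroAt_of_isZero h
      omega
    · exact backTarget_one h

end BackTargets

/-! ### Words with prescribed zeros, and counting differing nodes -/

section Words

variable {n w w' : ℕ}

theorem InRange.pos (h : InRange n w) : 1 ≤ n := by
  rcases n with _ | n
  · have := h.1; have := h.2; simp at *; omega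
  · omega

theorem InRange.lt (h : InRange n w) : w < 2 ^ n := by
  have := h.2
  have := Nat.two_pow_pos n
  omega

theorem InRange.isOne_one (h : InRange n w) : isOne n w 1 = true := by
  have h₁ := h.pos
  refine isOne_iff.2 ⟨le_rfl, h₁, ?_⟩
  have h₂ := h.lt
  rw [bit, Nat.testBit_eq_decide_div_mod_eq]
  have h₃ : w / 2 ^ (n - 1) = 1 := by
    rw [Nat.div_eq_iff (Nat.two_pow_pos _)]
    have : 2 ^ n = 2 ^ (n - 1) * 2 := by rw [← pow_succ]; congr 1; omega
    have := h.1
    omega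
  simp [h₃]

theorem InRange.eq_of_isOne_eq (h : InRange n w) (h' : InRange n w')
    (heq : ∀ i, 1 ≤ i → i ≤ n → isOne n w i = isOne n w' i) : w = w' := by
  apply Nat.eq_of_testBit_eq
  intro j
  by_cases hj : j < n
  · have := heq (n - j) (by omega) (by omega)
    simpa [isOne, bit, show 1 ≤ n - j by omega, show n - (n - j) = j by omega] using this
  · have hp : 2 ^ n ≤ 2 ^ j := Nat.pow_le_pow_right (by omega) (by omega)
    rw [Nat.testBit_eq_false_of_lt (h.lt.trans_le hp),
      Nat.testBit_eq_false_of_lt (h'.lt.trans_le hp)]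

theorem exists_inRange {f : ℕ → Bool} (hn : 1 ≤ n) (hf : f 1 = true) :
    ∃ w, InRange n w ∧ ∀ i, 1 ≤ i → i ≤ n → isOne n w i = f i := by
  have key : ∀ j (hj : j < n), (Nat.ofBits fun j : Fin n => f (n - j)).testBit j = f (n - j) :=
    fun j hj => Nat.testBit_ofBits_lt _ j hj
  refine ⟨Nat.ofBits fun j : Fin n => f (n - j), ⟨?_, ?_⟩, ?_⟩
  · apply Nat.ge_two_pow_of_testBit
    rw [key _ (by omega), show n - (n - 1) = 1 by omega, hf]
  · have := Nat.ofBits_lt_two_pow fun j : Fin n => f (n - j)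
    omega
  · intro i h₁ h₂
    rw [isOne, bit, key _ (by omega), show n - (n - i) = i by omega]
    simp [h₁, h₂]

theorem InRange.two_le_zeroAt (h : InRange n w) (m : ℕ) : 2 ≤ zeroAt n w m := by
  have h₁ := isZero_zeroAt (n := n) (w := w) m
  by_contra hlt
  have h₂ : zeroAt n w m = 1 := by have := h₁.1; omega
  have := h₁.2
  rw [h₂, h.isOne_one] at this
  exact absurd this (by decide)

theorem noZero_of_isOne (h : ∀ i, 1 ≤ i → i ≤ n → isOne n w i = true) : n < zeroAt n w 0 := by
  have h₁ := isZero_zeroAt (n := n) (w := w) 0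
  by_contra hlt
  have := h _ h₁.1 (not_lt.1 hlt)
  rw [h₁.2] at this
  exact absurd this (by decide)

theorem oneZero_of_isOne {z : ℕ} (h₁ : 1 ≤ z) (h₂ : z ≤ n) (hz : isOne n w z = false)
    (h : ∀ i, 1 ≤ i → i ≤ n → i ≠ z → isOne n w i = true) : OneZero n w z := by
  have h₃ : zeroAt n w 0 = z :=
    zeroAt_zero_eq ⟨h₁, hz⟩ fun i hi hiz => h i hi (by omega) (by omega)
  refine ⟨h₂, h₃, zeroAt_succ_eq (isZero_of_lt (by omega)) (by omega) fun i hi hiz => ?_⟩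
  exact h i (by omega) (by omega) (by omega)

theorem twoZeros_of_isOne {z : ℕ} (h₁ : 1 ≤ z) (h₂ : z < n) (hz : isOne n w z = false)
    (hn : isOne n w n = false)
    (h : ∀ i, 1 ≤ i → i < n → i ≠ z → isOne n w i = true) : TwoZeros n w z := by
  have h₃ : zeroAt n w 0 = z :=
    zeroAt_zero_eq ⟨h₁, hz⟩ fun i hi hiz => h i hi (by omega) (by omega)
  have h₄ : zeroAt n w 1 = n :=
    zeroAt_succ_eq ⟨by omega, hn⟩ (by omega) fun i hi hiz => h i (by omega) (by omega) (by omega)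
  exact ⟨h₂, h₃, h₄, zeroAt_succ_eq (isZero_of_lt (by omega)) (by omega) fun i hi hiz => by omega⟩

theorem exists_noZero (hn : 1 ≤ n) : ∃ w, InRange n w ∧ n < zeroAt n w 0 := by
  obtain ⟨w, hw, h⟩ := exists_inRange (f := fun _ => true) hn rfl
  exact ⟨w, hw, noZero_of_isOne h⟩

theorem exists_oneZero {z : ℕ} (h₁ : 2 ≤ z) (h₂ : z ≤ n) : ∃ w, InRange n w ∧ OneZero n w z := by
  obtain ⟨w, hw, h⟩ := exists_inRange (n := n) (f := fun i => decide (i ≠ z)) (by omega)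
    (by simp; omega)
  refine ⟨w, hw, oneZero_of_isOne (by omega) h₂ ?_ fun i hi hin hz => ?_⟩
  · rw [h z (by omega) h₂]; simp
  · rw [h i hi hin]; simp [hz]

theorem exists_twoZeros {z : ℕ} (h₁ : 2 ≤ z) (h₂ : z < n) :
    ∃ w, InRange n w ∧ TwoZeros n w z := by
  obtain ⟨w, hw, h⟩ := exists_inRange (n := n) (f := fun i => decide (i ≠ z ∧ i ≠ n)) (by omega)
    (by simp; omega)
  refine ⟨w, hw, twoZeros_of_isOne (by omega) h₂ ?_ ?_ fun i hi hin hz => ?_⟩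
  · rw [h z (by omega) h₂.le]; simp
  · rw [h n (by omega) le_rfl]; simp
  · rw [h i hi hin.le]; simp [hz]; omega

theorem noZero_unique (hw : InRange n w) (hw' : InRange n w') (h : n < zeroAt n w 0)
    (h' : n < zeroAt n w' 0) : w = w' :=
  hw.eq_of_isOne_eq hw' fun i h₁ h₂ => by
    rw [isOne_of_no_zero h h₁ h₂, isOne_of_no_zero h' h₁ h₂]

theorem isOne_congr_of_zeros (hzero : ∀ i, i ≤ n → (IsZero n w i ↔ IsZero n w' i))
    {i : ℕ} (h₁ : 1 ≤ i) (h₂ : i ≤ n) : isOne n w i = isOne n w' i := by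
  have := hzero i h₂
  simp only [IsZero, h₁, true_and] at this
  cases h : isOne n w i <;> cases h' : isOne n w' i <;> simp_all

theorem OneZero.isZero_iff {z : ℕ} (h : OneZero n w z) {i : ℕ} (h₂ : i ≤ n) :
    IsZero n w i ↔ i = z := by
  obtain ⟨hz, h₃, h₄⟩ := h
  constructor
  · intro hi
    have := eq_zeroAt_of_isZero hi
    have := zeroAt_one_lt (n := n) (w := w)
    omega
  · rintro rfl
    exact h₃ ▸ isZero_zeroAt 0

theorem TwoZeros.isZero_iff {z : ℕ} (h : TwoZeros n w z) {i : ℕ} (h₂ : i ≤ n) :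
    IsZero n w i ↔ i = z ∨ i = n := by
  obtain ⟨hz, h₃, h₄, h₅⟩ := h
  constructor
  · intro hi
    have := eq_zeroAt_of_isZero hi
    omega
  · rintro (rfl | rfl)
    · exact h₃ ▸ isZero_zeroAt 0
    · have := isZero_zeroAt (n := i) (w := w) 1
      rwa [h₄] at this

theorem OneZero.unique {z : ℕ} (hw : InRange n w) (hw' : InRange n w') (h : OneZero n w z)
    (h' : OneZero n w' z) : w = w' :=
  hw.eq_of_isOne_eq hw' fun _ h₁ h₂ =>
    isOne_congr_of_zeros (fun _ h₃ => by rw [h.isZero_iff h₃, h'.isZero_iff h₃]) h₁ h₂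

theorem TwoZeros.unique {z : ℕ} (hw : InRange n w) (hw' : InRange n w') (h : TwoZeros n w z)
    (h' : TwoZeros n w' z) : w = w' :=
  hw.eq_of_isOne_eq hw' fun _ h₁ h₂ =>
    isOne_congr_of_zeros (fun _ h₃ => by rw [h.isZero_iff h₃, h'.isZero_iff h₃]) h₁ h₂

theorem add_le_graphDist (A B : Finset ℕ)
    (hA : ∀ v ∈ A, 1 ≤ v ∧ v ≤ n ∧ backTarget n w v ≠ backTarget n w' v)
    (hB : ∀ i ∈ B, 1 ≤ i ∧ i ≤ n ∧ backTarget n w (n + i) ≠ backTarget n w' (n + i)) :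
    A.card + B.card ≤ graphDist n w w' := by
  rw [← Finset.card_image_of_injective B (add_right_injective n), ← Finset.card_union_of_disjoint]
  · refine Finset.card_le_card fun v hv => ?_
    rw [diffNodes, Finset.mem_filter, Finset.mem_Icc]
    rcases Finset.mem_union.1 hv with hv | hv
    · obtain ⟨h₁, h₂, h₃⟩ := hA v hv
      exact ⟨by omega, h₃⟩
    · obtain ⟨i, hi, rfl⟩ := Finset.mem_image.1 hv
      obtain ⟨h₁, h₂, h₃⟩ := hB i hi
      exact ⟨by omega, h₃⟩
  · rw [Finset.disjoint_left]
    intro v hv hv'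
    obtain ⟨i, hi, rfl⟩ := Finset.mem_image.1 hv'
    have := hA _ hv
    have := hB i hi
    omega

/-- The node `2n+1` needs no condition: it always points to the root. -/
theorem graphDist_le_add (A B : Finset ℕ)
    (hA : ∀ v, 1 ≤ v → v ≤ n → v ∉ A → backTarget n w v = backTarget n w' v)
    (hB : ∀ i, 1 ≤ i → i ≤ n → i ∉ B → backTarget n w (n + i) = backTarget n w' (n + i)) :
    graphDist n w w' ≤ A.card + B.card := by
  rw [← Finset.card_image_of_injective B (add_right_injective n)]
  refine (Finset.card_le_card fun v hv => ?_).trans (Finset.card_union_le A _)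
  rw [diffNodes, Finset.mem_filter, Finset.mem_Icc] at hv
  obtain ⟨⟨h₁, h₂⟩, h₃⟩ := hv
  rw [Finset.mem_union]
  by_contra hnot
  push Not at hnot
  apply h₃
  by_cases hvn : v ≤ n
  · exact hA v h₁ hvn hnot.1
  by_cases hlast : v = 2 * n + 1
  · rw [hlast, backTarget_last, backTarget_last]
  obtain ⟨i, rfl⟩ : ∃ i, v = n + i := ⟨v - n, by omega⟩
  exact hB i (by omega) (by omega) fun hi => hnot.2 (Finset.mem_image_of_mem _ hi)

theorem isMinVM_of_le {m : ℕ} (h₁ : ∃ w', InRange n w' ∧ w' ≠ w ∧ graphDist n w w' ≤ m)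
    (h₂ : ∀ w', InRange n w' → w' ≠ w → m ≤ graphDist n w w') : IsMinVM n w m := by
  obtain ⟨w', hr, hne, hle⟩ := h₁
  exact isMinVM_of_graphDist ⟨w', hr, hne, le_antisymm hle (h₂ w' hr hne)⟩ h₂

end Words

/-! ### Distances from words with at most one internal zero -/

section Distances

variable {n w w' : ℕ}

/-- The nodes below `z` point to `2n+1`. A competitor with no zero or with at least two redirects
all of them and at least three further nodes, which gives `z + 2`. A competitor with a single zero
elsewhere redirects every lower node from the smaller of the two zeros up to `n`, and both zeros. -/
theorem OneZero.le_graphDist {z : ℕ} (hw : InRange n w) (hw' : InRange n w') (hne : w' ≠ w)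
    (h : OneZero n w z) (hz₂ : 2 ≤ z) (hz : z < n) :
    z + 2 ≤ graphDist n w w' ∨ n + 3 - z ≤ graphDist n w w' := by
  have hab := zeroAt_zero_lt (n := n) (w := w')
  have hbc := zeroAt_one_lt (n := n) (w := w')
  have ha₂ := hw'.two_le_zeroAt 0
  rcases lt_or_ge n (zeroAt n w' 0) with ha | ha
  · left
    have := add_le_graphDist (n := n) (w := w) (w' := w') (Finset.Icc 1 n) {z} (by
      intro v hv
      rw [Finset.mem_Icc] at hv
      have := h.lower hv.1 hv.2
      have := backTarget_no_zero_lower ha hv.1 hv.2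
      omega) (by
      intro i hi
      obtain rfl := Finset.mem_singleton.1 hi
      have := h.upper (i := i) (by omega) (by omega)
      have := backTarget_no_zero_upper ha (i := i) (by omega) (by omega)
      omega)
    rw [Nat.card_Icc, Finset.card_singleton] at this
    omega
  rcases lt_or_ge n (zeroAt n w' 1) with hb | hb
  · right
    have h' : OneZero n w' (zeroAt n w' 0) := ⟨ha, rfl, by have := zeroAt_one_le ha; omega⟩
    have haz : zeroAt n w' 0 ≠ z := by
      intro heq
      rw [heq] at h'
      exact hne (h'.unique hw' hw h)
    have := add_le_graphDist (n := n) (w := w) (w' := w') (Finset.Icc (min (zeroAt n w' 0) z) n)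
      {z, zeroAt n w' 0} (by
      intro v hv
      rw [Finset.mem_Icc] at hv
      have := h.lower (v := v) (by omega) hv.2
      have := h'.lower (v := v) (by omega) hv.2
      omega) (by
      intro i hi
      have hi : i = z ∨ i = zeroAt n w' 0 := by simpa using hi
      have := h.upper (i := i) (by omega) (by omega)
      have := h'.upper (i := i) (by omega) (by omega)
      omega)
    rw [Nat.card_Icc, Finset.card_pair haz.symm] at this
    omega
  left
  have hfst := backTarget_first ha
  have hsnd := backTarget_second hb
  have hc := zeroAt_two_le hb
  have hlow : ∀ v ∈ Finset.Icc 1 (z - 1), 1 ≤ v ∧ v ≤ n ∧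
      backTarget n w v ≠ backTarget n w' v := by
    intro v hv
    rw [Finset.mem_Icc] at hv
    have := h.lower (v := v) (by omega) (by omega)
    have := backTarget_lower (v := v) ha (by omega) (by omega)
    omega
  rcases isZero_or_isOne (n := n) (w := w') (show 1 ≤ z by omega) with hzz | hzo
  · rcases lt_or_ge (zeroAt n w' 0) z with haz | haz
    · have := add_le_graphDist (n := n) (w := w) (w' := w') (Finset.Icc 1 n)
        {zeroAt n w' 0} (by
        intro v hv
        rw [Finset.mem_Icc] at hv
        have := h.lower (v := v) (by omega) (by omega)
        have := backTarget_lower (v := v) ha (by omega) (by omega)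
        omega) (by
        intro i hi
        have hi : i = zeroAt n w' 0 := by simpa using hi
        have := h.upper (i := i) (by omega) (by omega)
        rw [← hi] at hfst
        omega)
      rw [Nat.card_Icc, Finset.card_singleton] at this
      omega
    · have haz : zeroAt n w' 0 = z := by
        have := eq_zeroAt_of_isZero hzz
        omega
      have hsub := backTarget_n_sub_one hb
      have := add_le_graphDist (n := n) (w := w) (w' := w') (insert (n - 1) (Finset.Icc 1 (z - 1)))
        {z, zeroAt n w' 1} (by
        intro v hv
        rcases Finset.mem_insert.1 hv with rfl | hv
        · have := h.lower (v := n - 1) (by omega) (by omega)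
          omega
        · exact hlow v hv) (by
        intro i hi
        have hi : i = z ∨ i = zeroAt n w' 1 := by simpa using hi
        have := h.upper (i := i) (by omega) (by omega)
        rw [haz] at hfst
        rcases hi with rfl | rfl <;> omega)
      rw [Finset.card_insert_of_notMem (by rw [Finset.mem_Icc]; omega), Nat.card_Icc,
        Finset.card_pair (by omega)] at this
      omega
  · have hz₀ : z ≠ zeroAt n w' 0 := by
      rintro rfl; rw [(isZero_zeroAt 0).2] at hzo; exact absurd hzo (by decide)
    have hz₁ : z ≠ zeroAt n w' 1 := by
      rintro rfl; rw [(isZero_zeroAt 1).2] at hzo; exact absurd hzo (by decide)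
    have hone := backTarget_one hzo
    have := add_le_graphDist (n := n) (w := w) (w' := w') (Finset.Icc 1 (z - 1))
      {z, zeroAt n w' 0, zeroAt n w' 1} hlow (by
      intro i hi
      have hi : i = z ∨ i = zeroAt n w' 0 ∨ i = zeroAt n w' 1 := by simpa using hi
      have := h.upper (i := i) (by omega) (by omega)
      rcases hi with rfl | rfl | rfl <;> omega)
    rw [Nat.card_Icc, Finset.card_eq_three.2 ⟨_, _, _, hz₀, hz₁, by omega, rfl⟩] at this
    omega

theorem isOne_zeroAt_false {m : ℕ} : isOne n w (zeroAt n w m) = false := (isZero_zeroAt m).2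

/-- The nodes below `z` point to `2n`, which only survives in a competitor that has no zero or has
its second zero at `n`. The third alternative occurs when the zero at `z` moves right to some place
before `n`, which requires `z + 1 < n`. -/
theorem TwoZeros.le_graphDist {z : ℕ} (hw : InRange n w) (hw' : InRange n w') (hne : w' ≠ w)
    (h : TwoZeros n w z) (hz₂ : 2 ≤ z) :
    z + 2 ≤ graphDist n w w' ∨ n + 3 - z ≤ graphDist n w w' ∨
      (z + 1 < n ∧ n + 2 - z ≤ graphDist n w w') := by
  have hz := h.1
  have hab := zeroAt_zero_lt (n := n) (w := w')
  have hbc := zeroAt_one_lt (n := n) (w := w')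
  have ha₂ := hw'.two_le_zeroAt 0
  rcases lt_or_ge n (zeroAt n w' 0) with ha | ha
  · right; left
    have := add_le_graphDist (n := n) (w := w) (w' := w') (Finset.Icc z n) {z, n} (by
      intro v hv
      rw [Finset.mem_Icc] at hv
      have := h.lower (v := v) (by omega) hv.2
      have := backTarget_no_zero_lower ha (v := v) (by omega) hv.2
      omega) (by
      intro i hi
      have hi : i = z ∨ i = n := by simpa using hi
      have := h.upper (i := i) (by omega) (by omega)
      have := backTarget_no_zero_upper ha (i := i) (by omega) (by omega)
      omega)
    rw [Nat.card_Icc, Finset.card_pair (by omega)] at this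
    omega
  have hfst := backTarget_first ha
  rcases lt_or_ge n (zeroAt n w' 1) with hb | hb
  · left
    have h' : OneZero n w' (zeroAt n w' 0) := ⟨ha, rfl, by have := zeroAt_one_le ha; omega⟩
    generalize zeroAt n w' 0 = y at *
    by_cases hyn : y = n
    · have := add_le_graphDist (n := n) (w := w) (w' := w') (Finset.Icc 1 n) {z} (by
        intro v hv
        rw [Finset.mem_Icc] at hv
        have := h.lower (v := v) (by omega) hv.2
        have := h'.lower (v := v) (by omega) hv.2
        omega) (by
        intro i hi
        have hi : i = z := by simpa using hi
        have := h.upper (i := i) (by omega) (by omega)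
        have := h'.upper (i := i) (by omega) (by omega)
        omega)
      rw [Nat.card_Icc, Finset.card_singleton] at this
      omega
    have hlow : ∀ v ∈ Finset.Icc 1 (z - 1), 1 ≤ v ∧ v ≤ n ∧
        backTarget n w v ≠ backTarget n w' v := by
      intro v hv
      rw [Finset.mem_Icc] at hv
      have := h.lower (v := v) (by omega) (by omega)
      have := h'.lower (v := v) (by omega) (by omega)
      omega
    by_cases hyz : y = z
    · have := add_le_graphDist (n := n) (w := w) (w' := w')
        (insert (n - 1) (Finset.Icc 1 (z - 1))) {z, n} (by
        intro v hv
        rcases Finset.mem_insert.1 hv with rfl | hv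
        · have := h.lower (v := n - 1) (by omega) (by omega)
          have := h'.lower (v := n - 1) (by omega) (by omega)
          omega
        · exact hlow v hv) (by
        intro i hi
        have hi : i = z ∨ i = n := by simpa using hi
        have := h.upper (i := i) (by omega) (by omega)
        have := h'.upper (i := i) (by omega) (by omega)
        omega)
      rw [Finset.card_insert_of_notMem (by rw [Finset.mem_Icc]; omega), Nat.card_Icc,
        Finset.card_pair (by omega)] at this
      omega
    · have := add_le_graphDist (n := n) (w := w) (w' := w')
        (Finset.Icc 1 (z - 1)) {y, z, n} hlow (by
        intro i hi
        have hi : i = y ∨ i = z ∨ i = n := by simpa using hi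
        have := h.upper (i := i) (by omega) (by omega)
        have := h'.upper (i := i) (by omega) (by omega)
        omega)
      rw [Nat.card_Icc, Finset.card_eq_three.2 ⟨_, _, _, hyz, hyn, by omega, rfl⟩] at this
      omega
  have hsnd := backTarget_second hb
  have hc := zeroAt_two_le hb
  rcases isZero_or_isOne (n := n) (w := w') (show 1 ≤ n by omega) with hnz | hno
  · rcases lt_or_ge n (zeroAt n w' 2) with hc' | hc'
    · have h' : TwoZeros n w' (zeroAt n w' 0) :=
        ⟨by omega, rfl, by have := eq_zeroAt_of_isZero hnz; omega, by omega⟩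
      have hyz : zeroAt n w' 0 ≠ z := by
        intro heq
        rw [heq] at h'
        exact hne (h'.unique hw' hw h)
      have hup : ∀ i ∈ ({zeroAt n w' 0, z} : Finset ℕ), 1 ≤ i ∧ i ≤ n ∧
          backTarget n w (n + i) ≠ backTarget n w' (n + i) := by
        intro i hi
        have hi : i = zeroAt n w' 0 ∨ i = z := by simpa using hi
        have := h.upper (i := i) (by omega) (by omega)
        have := h'.upper (i := i) (by omega) (by omega)
        have := h'.1
        omega
      have h'n := h'.1
      -- The node `n - 1` points to `n` in both graphs, so it is left out of both intervals. A move
      -- to the left also redirects the node `z - 1`, hence the extra unit.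
      rcases lt_or_gt_of_ne hyz with hlt | hgt
      · right; left
        have := add_le_graphDist (n := n) (w := w) (w' := w')
          (insert n (Finset.Icc (z - 1) (n - 2))) {zeroAt n w' 0, z} (by
          intro v hv
          rw [Finset.mem_insert, Finset.mem_Icc] at hv
          have := h.lower (v := v) (by omega) (by omega)
          have := h'.lower (v := v) (by omega) (by omega)
          omega) hup
        rw [Finset.card_insert_of_notMem (by rw [Finset.mem_Icc]; omega), Nat.card_Icc,
          Finset.card_pair hyz] at this
        omega
      · right; right
        have := add_le_graphDist (n := n) (w := w) (w' := w')
          (insert n (Finset.Icc z (n - 2))) {zeroAt n w' 0, z} (by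
          intro v hv
          rw [Finset.mem_insert, Finset.mem_Icc] at hv
          have := h.lower (v := v) (by omega) (by omega)
          have := h'.lower (v := v) (by omega) (by omega)
          omega) hup
        rw [Finset.card_insert_of_notMem (by rw [Finset.mem_Icc]; omega), Nat.card_Icc,
          Finset.card_pair hyz] at this
        omega
    · have hlow : ∀ v ∈ Finset.Icc 1 (z - 1), 1 ≤ v ∧ v ≤ n ∧
          backTarget n w v ≠ backTarget n w' v := by
        intro v hv
        rw [Finset.mem_Icc] at hv
        have := h.lower (v := v) (by omega) (by omega)
        have := backTarget_lower (v := v) ha (by omega) (by omega)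
        omega
      rcases isZero_or_isOne (n := n) (w := w') (show 1 ≤ z by omega) with hzz | hzo
      · rcases lt_or_ge (zeroAt n w' 0) z with haz | haz
        · have := add_le_graphDist (n := n) (w := w) (w' := w')
            (insert n (Finset.Icc 1 (n - 2))) {zeroAt n w' 0} (by
            intro v hv
            rw [Finset.mem_insert, Finset.mem_Icc] at hv
            have := h.lower (v := v) (by omega) (by omega)
            have := backTarget_lower (v := v) ha (by omega) (by omega)
            omega) (by
            intro i hi
            have hi : i = zeroAt n w' 0 := by simpa using hi
            have := h.upper (i := i) (by omega) (by omega)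
            rw [← hi] at hfst
            omega)
          rw [Finset.card_insert_of_notMem (by rw [Finset.mem_Icc]; omega), Nat.card_Icc,
            Finset.card_singleton] at this
          omega
        · left
          have haz : zeroAt n w' 0 = z := by
            have := eq_zeroAt_of_isZero hzz
            omega
          have hsub := backTarget_n_sub_two hc'
          have := add_le_graphDist (n := n) (w := w) (w' := w')
            (insert (n - 2) (Finset.Icc 1 (z - 1))) {z, zeroAt n w' 1} (by
            intro v hv
            rcases Finset.mem_insert.1 hv with rfl | hv
            · have := h.lower (v := n - 2) (by omega) (by omega)
              omega
            · exact hlow v hv) (by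
            intro i hi
            have hi : i = z ∨ i = zeroAt n w' 1 := by simpa using hi
            have := h.upper (i := i) (by omega) (by omega)
            rw [haz] at hfst
            rcases hi with rfl | rfl <;> omega)
          rw [Finset.card_insert_of_notMem (by rw [Finset.mem_Icc]; omega), Nat.card_Icc,
            Finset.card_pair (by omega)] at this
          omega
      · left
        have hz₀ : z ≠ zeroAt n w' 0 := by
          rintro rfl; rw [isOne_zeroAt_false] at hzo; exact absurd hzo (by decide)
        have hz₁ : z ≠ zeroAt n w' 1 := by
          rintro rfl; rw [isOne_zeroAt_false] at hzo; exact absurd hzo (by decide)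
        have hone := backTarget_one hzo
        have := add_le_graphDist (n := n) (w := w) (w' := w') (Finset.Icc 1 (z - 1))
          {z, zeroAt n w' 0, zeroAt n w' 1} hlow (by
          intro i hi
          have hi : i = z ∨ i = zeroAt n w' 0 ∨ i = zeroAt n w' 1 := by simpa using hi
          have := h.upper (i := i) (by omega) (by omega)
          rcases hi with rfl | rfl | rfl <;> omega)
        rw [Nat.card_Icc, Finset.card_eq_three.2 ⟨_, _, _, hz₀, hz₁, by omega, rfl⟩] at this
        omega
  · left
    have hn₀ : n ≠ zeroAt n w' 0 := by
      intro heq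
      have := isOne_zeroAt_false (n := n) (w := w') (m := 0)
      rw [← heq, hno] at this
      exact absurd this (by decide)
    have hn₁ : n ≠ zeroAt n w' 1 := by
      intro heq
      have := isOne_zeroAt_false (n := n) (w := w') (m := 1)
      rw [← heq, hno] at this
      exact absurd this (by decide)
    have hn := backTarget_one hno
    have hlow : ∀ v ∈ Finset.Icc 1 (z - 1), 1 ≤ v ∧ v ≤ n ∧
        backTarget n w v ≠ backTarget n w' v := by
      intro v hv
      rw [Finset.mem_Icc] at hv
      have := h.lower (v := v) (by omega) (by omega)
      have := backTarget_lower (v := v) ha (by omega) (by omega)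
      omega
    -- Of the two first zeros of `w'`, neither is at `n` and at most one is at `z`. The nodes of
    -- `y`, `z` and `n` all change: for `z`, the old target `2n` is impossible because `b_n = 1` in
    -- `w'`.
    obtain ⟨y, hy, hyn, hyz⟩ : ∃ y, IsZero n w' y ∧ y < n ∧ y ≠ z := by
      by_cases hyz : zeroAt n w' 0 = z
      · exact ⟨_, isZero_zeroAt 1, by omega, by omega⟩
      · exact ⟨_, isZero_zeroAt 0, by omega, hyz⟩
    have hup : ∀ i ∈ ({y, z, n} : Finset ℕ), 1 ≤ i ∧ i ≤ n ∧
        backTarget n w (n + i) ≠ backTarget n w' (n + i) := by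
      intro i hi
      have hi : i = y ∨ i = z ∨ i = n := by simpa using hi
      have hy₁ := hy.1
      have := h.upper (i := i) (by omega) (by omega)
      refine ⟨by omega, by omega, ?_⟩
      rcases backTarget_upper (n := n) (w := w') (i := i) (by omega) (by omega) with
        ⟨hone, ht⟩ | ⟨-, j, hj, hjn, hjz, ht⟩
      · have : i ≠ y := by
          rintro rfl; rw [hy.2] at hone; exact absurd hone (by decide)
        omega
      · have : j ≠ n := by
          rintro rfl; rw [hjz.2] at hno; exact absurd hno (by decide)
        have : i = n → backTarget n w' (n + i) = 2 * n + 2 := by rintro rfl; exact hn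
        omega
    have := add_le_graphDist (Finset.Icc 1 (z - 1)) {y, z, n} hlow hup
    rw [Nat.card_Icc, Finset.card_eq_three.2 ⟨_, _, _, hyz, by omega, by omega, rfl⟩] at this
    omega

/-- A single zero redirects the lower nodes before `n` and its own node, `n` nodes in all; this is
where `4 ≤ n` is needed. Two zeros redirect their own nodes and the nodes `n - 1` and `n`. -/
theorem four_le_graphDist_of_no_zero (hw : InRange n w) (hw' : InRange n w') (hne : w' ≠ w)
    (h : n < zeroAt n w 0) (hn : 4 ≤ n) : 4 ≤ graphDist n w w' := by
  have hab := zeroAt_zero_lt (n := n) (w := w')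
  have hbc := zeroAt_one_lt (n := n) (w := w')
  have ha₂ := hw'.two_le_zeroAt 0
  rcases lt_or_ge n (zeroAt n w' 0) with ha | ha
  · exact absurd (noZero_unique hw' hw ha h) hne
  have hfst := backTarget_first ha
  have hfst' := backTarget_no_zero_upper h (i := zeroAt n w' 0) (by omega) ha
  have hn₀ := backTarget_n ha
  have hn₀' := backTarget_no_zero_lower h (v := n) (by omega) le_rfl
  rcases lt_or_ge n (zeroAt n w' 1) with hb | hb
  · have h' : OneZero n w' (zeroAt n w' 0) := ⟨ha, rfl, by have := zeroAt_one_le ha; omega⟩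
    have := add_le_graphDist (n := n) (w := w) (w' := w') (Finset.Icc 1 (n - 1))
      {zeroAt n w' 0} (by
      intro v hv
      rw [Finset.mem_Icc] at hv
      have := h'.lower (v := v) (by omega) (by omega)
      have := backTarget_no_zero_lower h (v := v) (by omega) (by omega)
      omega) (by
      intro i hi
      have hi : i = zeroAt n w' 0 := by simpa using hi
      have := h'.upper (i := i) (by omega) (by omega)
      have := backTarget_no_zero_upper h (i := i) (by omega) (by omega)
      omega)
    rw [Nat.card_Icc, Finset.card_singleton] at this
    omega
  have hsnd := backTarget_second hb
  have hsnd' := backTarget_no_zero_upper h (i := zeroAt n w' 1) (by omega) hb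
  have hc := zeroAt_two_le hb
  have hsub := backTarget_n_sub_one hb
  have hsub' := backTarget_no_zero_lower h (v := n - 1) (by omega) (by omega)
  have := add_le_graphDist (n := n) (w := w) (w' := w') {n - 1, n}
    {zeroAt n w' 0, zeroAt n w' 1} (by
    intro v hv
    have hv : v = n - 1 ∨ v = n := by simpa using hv
    rcases hv with rfl | rfl <;> omega) (by
    intro i hi
    have hi : i = zeroAt n w' 0 ∨ i = zeroAt n w' 1 := by simpa using hi
    rcases hi with rfl | rfl <;> omega)
  rwa [Finset.card_pair (by omega), Finset.card_pair (by omega)] at this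

/-- The nodes below `n` point to `2n+1`, which only another word with a single zero can preserve.
Any other competitor thus costs at least `n ≥ 4`; moving the zero changes both zeros and the nodes
`n - 1` and `n`. -/
theorem OneZero.four_le_graphDist (hw : InRange n w) (hw' : InRange n w') (hne : w' ≠ w)
    (h : OneZero n w n) (hn : 4 ≤ n) : 4 ≤ graphDist n w w' := by
  have hab := zeroAt_zero_lt (n := n) (w := w')
  have ha₂ := hw'.two_le_zeroAt 0
  rcases lt_or_ge n (zeroAt n w' 0) with ha | ha
  · have := add_le_graphDist (n := n) (w := w) (w' := w') (Finset.Icc 1 (n - 1)) {n} (by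
      intro v hv
      rw [Finset.mem_Icc] at hv
      have := h.lower (v := v) (by omega) (by omega)
      have := backTarget_no_zero_lower ha (v := v) (by omega) (by omega)
      omega) (by
      intro i hi
      have hi : i = n := by simpa using hi
      have := h.upper (i := i) (by omega) (by omega)
      have := backTarget_no_zero_upper ha (i := i) (by omega) (by omega)
      omega)
    rw [Nat.card_Icc, Finset.card_singleton] at this
    omega
  rcases lt_or_ge n (zeroAt n w' 1) with hb | hb
  · have h' : OneZero n w' (zeroAt n w' 0) := ⟨ha, rfl, by have := zeroAt_one_le ha; omega⟩
    have haz : zeroAt n w' 0 ≠ n := by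
      intro heq
      rw [heq] at h'
      exact hne (h'.unique hw' hw h)
    have := add_le_graphDist (n := n) (w := w) (w' := w') {n - 1, n} {zeroAt n w' 0, n} (by
      intro v hv
      have hv : v = n - 1 ∨ v = n := by simpa using hv
      have := h.lower (v := v) (by omega) (by omega)
      have := h'.lower (v := v) (by omega) (by omega)
      omega) (by
      intro i hi
      have hi : i = zeroAt n w' 0 ∨ i = n := by simpa using hi
      have := h.upper (i := i) (by omega) (by omega)
      have := h'.upper (i := i) (by omega) (by omega)
      omega)
    rwa [Finset.card_pair (by omega), Finset.card_pair haz] at this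
  · have hfst := backTarget_first ha
    have := add_le_graphDist (n := n) (w := w) (w' := w') (Finset.Icc 1 (n - 1))
      {zeroAt n w' 0} (by
      intro v hv
      rw [Finset.mem_Icc] at hv
      have := h.lower (v := v) (by omega) (by omega)
      have := backTarget_lower (v := v) ha (by omega) (by omega)
      omega) (by
      intro i hi
      have hi : i = zeroAt n w' 0 := by simpa using hi
      have := h.upper (i := i) (by omega) (by omega)
      rw [← hi] at hfst
      omega)
    rw [Nat.card_Icc, Finset.card_singleton] at this
    omega

theorem graphDist_oneZero_oneZero_le {z : ℕ} (h : OneZero n w z) (h' : OneZero n w' n)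
    (hz : z < n) : graphDist n w w' ≤ n + 3 - z := by
  have := graphDist_le_add (n := n) (w := w) (w' := w') (Finset.Icc z n) {z, n} (by
    intro v h₁ h₂ hv
    rw [Finset.mem_Icc] at hv
    have := h.lower h₁ h₂
    have := h'.lower h₁ h₂
    omega) (by
    intro i h₁ h₂ hi
    have hi : ¬ (i = z ∨ i = n) := by simpa using hi
    have := h.upper h₁ h₂
    have := h'.upper h₁ h₂
    omega)
  rw [Nat.card_Icc, Finset.card_pair (by omega)] at this
  omega

theorem graphDist_oneZero_twoZeros_le {z : ℕ} (h : OneZero n w z) (h' : TwoZeros n w' z)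
    (hz : 1 ≤ z) : graphDist n w w' ≤ z + 2 := by
  have hzn := h'.1
  have := graphDist_le_add (n := n) (w := w) (w' := w') (insert (n - 1) (Finset.Icc 1 (z - 1)))
    {z, n} (by
    intro v h₁ h₂ hv
    rw [Finset.mem_insert, Finset.mem_Icc] at hv
    have := h.lower h₁ h₂
    have := h'.lower h₁ h₂
    omega) (by
    intro i h₁ h₂ hi
    have hi : ¬ (i = z ∨ i = n) := by simpa using hi
    have := h.upper h₁ h₂
    have := h'.upper h₁ h₂
    omega)
  rw [Finset.card_insert_of_notMem (by rw [Finset.mem_Icc]; omega), Nat.card_Icc,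
    Finset.card_pair (by omega)] at this
  omega

/-- The second zero stays at `n`, so the nodes below `z` keep their target `2n`, and `n - 1` keeps
its target `n`. -/
theorem graphDist_twoZeros_twoZeros_le {z : ℕ} (h : TwoZeros n w z) (h' : TwoZeros n w' (n - 1))
    (hz : z + 1 < n) : graphDist n w w' ≤ n + 2 - z := by
  have := graphDist_le_add (n := n) (w := w) (w' := w') (insert n (Finset.Icc z (n - 2)))
    {z, n - 1} (by
    intro v h₁ h₂ hv
    rw [Finset.mem_insert, Finset.mem_Icc] at hv
    have := h.lower h₁ h₂
    have := h'.lower h₁ h₂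
    omega) (by
    intro i h₁ h₂ hi
    have hi : ¬ (i = z ∨ i = n - 1) := by simpa using hi
    have := h.upper h₁ h₂
    have := h'.upper h₁ h₂
    omega)
  rw [Finset.card_insert_of_notMem (by rw [Finset.mem_Icc]; omega), Nat.card_Icc,
    Finset.card_pair (by omega)] at this
  omega

theorem graphDist_twoZeros_no_zero_le (h : TwoZeros n w (n - 1)) (h' : n < zeroAt n w' 0) :
    graphDist n w w' ≤ 4 := by
  have hn := h.1
  have := graphDist_le_add (n := n) (w := w) (w' := w') {n - 1, n} {n - 1, n} (by
    intro v h₁ h₂ hv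
    have hv : ¬ (v = n - 1 ∨ v = n) := by simpa using hv
    have := h.lower h₁ h₂
    have := backTarget_no_zero_lower h' h₁ h₂
    omega) (by
    intro i h₁ h₂ hi
    have hi : ¬ (i = n - 1 ∨ i = n) := by simpa using hi
    have := h.upper h₁ h₂
    have := backTarget_no_zero_upper h' h₁ h₂
    omega)
  rwa [Finset.card_pair (by omega)] at this

end Distances

/-! ### The minimum three for words with two internal zeros -/

section Generic

variable {n w w' : ℕ}

theorem count_congr {p q : ℕ → Prop} [DecidablePred p] [DecidablePred q] {i : ℕ}
    (h : ∀ j < i, p j ↔ q j) : Nat.count p i = Nat.count q i := by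
  induction i with
  | zero => simp
  | succ i ih =>
    rw [Nat.count_succ, Nat.count_succ, ih fun j hj => h j (by omega)]
    simp only [h i (by omega)]

theorem zerosBefore_congr {i : ℕ} (h : ∀ j, 1 ≤ j → j < i → isOne n w j = isOne n w' j) :
    zerosBefore n w i = zerosBefore n w' i :=
  count_congr fun j hj => by
    rw [IsZero, IsZero]
    exact and_congr_right fun h₁ => by rw [h j h₁ hj]

theorem onesBefore_congr {i : ℕ} (h : ∀ j, 1 ≤ j → j < i → isOne n w j = isOne n w' j) :
    onesBefore n w i = onesBefore n w' i := by
  rcases Nat.eq_zero_or_pos i with rfl | hi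
  · simp [onesBefore]
  · have h₁ := onesBefore_eq (n := n) (w := w) hi
    have h₂ := onesBefore_eq (n := n) (w := w') hi
    have h₃ := zerosBefore_congr h
    omega

theorem zeroAt_congr {i m : ℕ} (h : ∀ j, 1 ≤ j → j < i → isOne n w j = isOne n w' j)
    (hm : m < zerosBefore n w i) : zeroAt n w m = zeroAt n w' m := by
  have hlt : zeroAt n w m < i := by
    by_contra hle
    have := zerosBefore_mono (n := n) (w := w) (not_lt.1 hle)
    rw [zerosBefore_zeroAt] at this
    omega
  have h₁ := isZero_zeroAt (n := n) (w := w) m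
  have h₂ : IsZero n w' (zeroAt n w m) := ⟨h₁.1, h _ h₁.1 hlt ▸ h₁.2⟩
  have h₃ := zeroAt_zerosBefore h₂
  rwa [← zerosBefore_congr fun j hj hjm => h j hj (by omega), zerosBefore_zeroAt, eq_comm] at h₃

theorem backTarget_of_isLevel {v M : ℕ} (h : IsLevel n w v M) (ha : zeroAt n w 0 ≤ n) :
    (M = 0 ∧ backTarget n w v = n + zeroAt n w 1) ∨
      (M = 1 ∧ backTarget n w v = n + zeroAt n w 0) ∨
      (2 ≤ M ∧ M ≤ n ∧ backTarget n w v = n + 2 - M) := by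
  match M, h with
  | 0, h => exact Or.inl ⟨rfl, backTarget_eq (isDmax_of_level_zero h (one_le_zerosBefore ha))⟩
  | 1, h => exact Or.inr (Or.inl ⟨rfl, backTarget_eq (isDmax_of_level_one h)⟩)
  | M + 2, h =>
    have h₁ := h.le
    have h₂ := onesBefore_add_zerosBefore (n := n) (w := w) n
    refine Or.inr (Or.inr ⟨by omega, by omega, ?_⟩)
    rw [backTarget_eq (isDmax_of_level_two_le h)]
    omega

/-- Either `n` works or the rank `v` of the one at `i` does. The level of `v` is larger in `w'`,
where a zero takes the place of this one. Different levels have different targets, except that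
levels 0 and 1 could agree if the second zero of `w` were the first zero of `w'`; agreement at the
node `n` excludes this, since it makes the first zeros equal. -/
theorem exists_lower_ne {i : ℕ} (h : ∀ j, 1 ≤ j → j < i → isOne n w j = isOne n w' j)
    (hi : isOne n w i = true) (hi' : IsZero n w' i)
    (ha : zeroAt n w 0 ≤ n) (ha' : zeroAt n w' 0 ≤ n) :
    ∃ v, 1 ≤ v ∧ v ≤ n ∧ backTarget n w v ≠ backTarget n w' v := by
  by_contra hall
  push Not at hall
  obtain ⟨h₁, h₂, -⟩ := isOne_iff.1 hi
  have hlt := onesBefore_lt hi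
  have h₃ := zerosBefore_congr h
  have h₄ := onesBefore_congr h
  have h₅ := onesBefore_eq (n := n) (w := w) h₁
  have hlev : IsLevel n w (onesBefore n w i + 1) (zerosBefore n w i) :=
    Or.inl ⟨i, h₂, hi, rfl, rfl⟩
  obtain ⟨M, hM⟩ := exists_isLevel (n := n) (w := w') (v := onesBefore n w i + 1) (by omega)
    (by omega)
  have hlt : zerosBefore n w i < M := by
    rcases hM with ⟨j, hj, hjo, hjc, rfl⟩ | hM
    · rw [h₃]
      refine zerosBefore_lt_of_lt hi' ?_
      by_contra hle
      rcases (not_lt.1 hle).eq_or_lt with rfl | hlt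
      · rw [hi'.2] at hjo
        exact absurd hjo (by decide)
      · have := onesBefore_lt_of_lt hjo hlt
        omega
    · omega
  have hn := hall n (by omega) le_rfl
  rw [backTarget_n ha, backTarget_n ha'] at hn
  have heq := hall _ (by omega) (show onesBefore n w i + 1 ≤ n by omega)
  have := backTarget_of_isLevel hlev ha
  have := backTarget_of_isLevel hM ha'
  have := zeroAt_zero_lt (n := n) (w := w)
  have := (isZero_zeroAt (n := n) (w := w) 0).1
  omega

theorem backTarget_upper_of_zero {i j : ℕ} (h : IsZero n w i) (hij : i < j) (hj : j ≤ n)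
    (hj' : IsZero n w j) (hone : ∀ t, i < t → t < j → isOne n w t = true) :
    backTarget n w (n + i) = n + j := by
  have h₁ := zeroAt_zerosBefore h
  have h₂ := backTarget_zeroAt (n := n) (w := w) (m := zerosBefore n w i) (by omega)
  rw [h₁, zeroAt_succ_eq hj' (by omega) (by rwa [h₁])] at h₂
  exact h₂

theorem backTarget_upper_ne {i : ℕ} (h₁ : 1 ≤ i) (h₂ : i ≤ n)
    (h : isOne n w i ≠ isOne n w' i) :
    backTarget n w (n + i) ≠ backTarget n w' (n + i) := by
  rcases backTarget_upper (n := n) (w := w) h₁ h₂ with ⟨h₃, h₄⟩ | ⟨h₃, j, -, hj, -, h₄⟩ <;>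
    rcases backTarget_upper (n := n) (w := w') h₁ h₂ with ⟨h₅, h₆⟩ | ⟨h₅, j', -, hj', -, h₆⟩
  · exact absurd (h₃.trans h₅.symm) h
  · omega
  · omega
  · exact absurd (h₃.2.trans h₅.2.symm) h

/-- The node `n + i` and some lower node change. A third one is the last zero before `i`, which
points to `n + i` only in `w'`. If no zero precedes `i`, another differing bit supplies it; and if
`i` is the only differing bit, both lower nodes `1` and `n` change, as the first and second zeros
both shift. -/
theorem three_le_graphDist_of_first {i : ℕ} (hw : InRange n w)
    (hw' : InRange n w')
    (h : ∀ j, 1 ≤ j → j < i → isOne n w j = isOne n w' j)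
    (hi : isOne n w i = true) (hi' : IsZero n w' i)
    (ha : zeroAt n w 0 ≤ n) (ha' : zeroAt n w' 0 ≤ n) : 3 ≤ graphDist n w w' := by
  obtain ⟨h₁, h₂, -⟩ := isOne_iff.1 hi
  have hne : isOne n w i ≠ isOne n w' i := by rw [hi, hi'.2]; decide
  have hupper := backTarget_upper_ne h₁ h₂ hne
  obtain ⟨v, hv₁, hv₂, hv⟩ := exists_lower_ne h hi hi' ha ha'
  have htwo : ∀ j, 1 ≤ j → j ≤ n → j ≠ i →
      backTarget n w (n + j) ≠ backTarget n w' (n + j) → 3 ≤ graphDist n w w' := by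
    intro j hj₁ hj₂ hji hj
    have := add_le_graphDist (n := n) (w := w) (w' := w') {v} {i, j}
      (by simpa using ⟨hv₁, hv₂, hv⟩)
      (by simpa using ⟨⟨h₁, h₂, hupper⟩, hj₁, hj₂, hj⟩)
    rwa [Finset.card_pair hji.symm, Finset.card_singleton] at this
  have hzb := zerosBefore_congr h
  rcases Nat.eq_zero_or_pos (zerosBefore n w i) with h₀ | hpos
  · have ha'i : zeroAt n w' 0 = i :=
      zeroAt_zero_eq hi' fun j hj hji => isOne_of_zerosBefore_eq_zero (hzb ▸ h₀) hj hji
    have hai : i < zeroAt n w 0 := by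
      by_contra hle
      have hz := isZero_zeroAt (n := n) (w := w) 0
      rcases (not_lt.1 hle).eq_or_lt with heq | hlt
      · rw [← heq, hz.2] at hi
        exact absurd hi (by decide)
      · have := zerosBefore_lt_of_lt hz hlt
        omega
    by_cases hall : ∀ j, i < j → j ≤ n → isOne n w j = isOne n w' j
    · have ha₁ := isZero_zeroAt (n := n) (w := w) 0
      have hb' : zeroAt n w' 1 = zeroAt n w 0 := by
        refine zeroAt_succ_eq ⟨ha₁.1, hall _ hai ha ▸ ha₁.2⟩ (by omega) fun j hj hj' => ?_
        rw [← hall j (by omega) (by omega)]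
        exact isOne_of_lt_zeroAt (by omega) hj' (Nat.zero_le _)
      have h₃ := zeroAt_zero_lt (n := n) (w := w)
      have h₄ := hw.two_le_zeroAt 0
      have h₅ := hw'.two_le_zeroAt 0
      have hn := backTarget_n ha
      have hn' := backTarget_n ha'
      have ho := backTarget_of_lt ha le_rfl (by omega)
      have ho' := backTarget_of_lt ha' le_rfl (by omega)
      have := add_le_graphDist (n := n) (w := w) (w' := w') {1, n} {i} (by
        intro v hv
        have hv : v = 1 ∨ v = n := by simpa using hv
        rcases hv with rfl | rfl <;> omega) (by simpa using ⟨h₁, h₂, hupper⟩)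
      rwa [Finset.card_pair (by omega), Finset.card_singleton] at this
    · push Not at hall
      obtain ⟨j, hj₁, hj₂, hj⟩ := hall
      exact htwo j (by omega) hj₂ (by omega) (backTarget_upper_ne (by omega) hj₂ hj)
  · obtain ⟨j, hji, hj, hjc⟩ := exists_of_lt_count (p := IsZero n w) (j := i)
      (m := zerosBefore n w i - 1) (by rw [zerosBefore] at hpos ⊢; omega)
    have hjc : zerosBefore n w j = zerosBefore n w i - 1 := hjc
    have hj' : IsZero n w' j := ⟨hj.1, h j hj.1 hji ▸ hj.2⟩
    have hbetween : ∀ t, j < t → t < i → isOne n w' t = true := by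
      intro t hjt hti
      have := hj.1
      rw [← h t (by omega) hti]
      rcases isZero_or_isOne (n := n) (w := w) (show 1 ≤ t by omega) with ht | ht
      · have h₃ := zerosBefore_lt_of_lt ht hti
        have h₄ := zerosBefore_lt_of_lt hj hjt
        omega
      · exact ht
    have h₃ := backTarget_upper_of_zero hj' hji h₂ hi' hbetween
    refine htwo j hj.1 (by omega) (by omega) ?_
    rcases backTarget_upper (n := n) (w := w) hj.1 (show j ≤ n by omega) with
      ⟨h₄, -⟩ | ⟨-, t, -, -, ht, h₄⟩
    · rw [hj.2] at h₄
      exact absurd h₄ (by decide)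
    · have : t ≠ i := by
        rintro rfl
        rw [ht.2] at hi
        exact absurd hi (by decide)
      omega

theorem three_le_graphDist (hw : InRange n w) (hw' : InRange n w') (hne : w' ≠ w)
    (hb : zeroAt n w 1 ≤ n) : 3 ≤ graphDist n w w' := by
  have hab := zeroAt_zero_lt (n := n) (w := w)
  have ha : zeroAt n w 0 ≤ n := by omega
  have hpos := hw.two_le_zeroAt 0
  rcases lt_or_ge n (zeroAt n w' 0) with ha' | ha'
  · have h₁ := backTarget_first ha
    have h₂ := backTarget_second hb
    have h₃ := zeroAt_two_le hb
    have h₄ := backTarget_n ha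
    have h₅ := backTarget_no_zero_lower ha' (v := n) (by omega) le_rfl
    have := add_le_graphDist (n := n) (w := w) (w' := w') {n} {zeroAt n w 0, zeroAt n w 1} (by
      intro v hv
      obtain rfl := Finset.mem_singleton.1 hv
      omega) (by
      intro i hi
      have hi : i = zeroAt n w 0 ∨ i = zeroAt n w 1 := by simpa using hi
      have := backTarget_no_zero_upper ha' (i := i) (by omega) (by omega)
      rcases hi with rfl | rfl <;> omega)
    rwa [Finset.card_pair (by omega), Finset.card_singleton] at this
  have hex : ∃ i, 1 ≤ i ∧ i ≤ n ∧ isOne n w i ≠ isOne n w' i := by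
    by_contra hall
    push Not at hall
    exact hne (hw.eq_of_isOne_eq hw' hall).symm
  classical
  obtain ⟨h₁, h₂, h₃⟩ := Nat.find_spec hex
  have hmin : ∀ j, 1 ≤ j → j < Nat.find hex → isOne n w j = isOne n w' j := by
    intro j hj hlt
    by_contra hj'
    exact Nat.find_min hex hlt ⟨hj, by omega, hj'⟩
  generalize Nat.find hex = i at *
  rcases isZero_or_isOne (n := n) (w := w) h₁ with hz | ho
  · rcases isZero_or_isOne (n := n) (w := w') h₁ with hz' | ho'
    · exact absurd (hz.2.trans hz'.2.symm) h₃
    · rw [graphDist_comm]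
      exact three_le_graphDist_of_first hw' hw (fun j hj hlt => (hmin j hj hlt).symm) ho' hz
        ha' ha
  · rcases isZero_or_isOne (n := n) (w := w') h₁ with hz' | ho'
    · exact three_le_graphDist_of_first hw hw' hmin ho hz' ha ha'
    · exact absurd (ho.trans ho'.symm) h₃

/-- Two zeros before `n` fix the targets of levels 0 and 1, so a lower node changes only if its
level does. That happens only to the rank of the new one at `n`; among the upper nodes only `n` and
the last zero before it are affected. -/
theorem graphDist_flip_last_le (hzn : isOne n w n = false) (hon : isOne n w' n = true)
    (h : ∀ j, 1 ≤ j → j < n → isOne n w j = isOne n w' j) (hz : 2 ≤ zerosBefore n w n) :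
    graphDist n w w' ≤ 3 := by
  have hn := (isOne_iff.1 hon).1
  have hzero : IsZero n w n := ⟨hn, hzn⟩
  have h₀ := zeroAt_congr h (m := 0) (by omega)
  have h₁ := zeroAt_congr h (m := 1) (by omega)
  have hzb := zerosBefore_congr h
  have hob := onesBefore_congr h
  have hob₁ := onesBefore_succ_of_zero hzero
  have hob₂ := onesBefore_succ_of_one hon
  have ha : zeroAt n w 0 ≤ n := by
    have := zerosBefore_mono (n := n) (w := w) (show n ≤ n + 1 by omega)
    have := zeroAt_zero_lt (n := n) (w := w)
    have := (zeroAt_le_iff (n := n) (w := w) (m := 1)).2 (by omega)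
    omega
  have := graphDist_le_add (n := n) (w := w) (w' := w') {onesBefore n w (n + 1) + 1}
    {n, zeroAt n w (zerosBefore n w n - 1)} (by
    intro v hv₁ hv₂ hv
    rw [Finset.mem_singleton] at hv
    obtain ⟨M, hM⟩ := exists_isLevel (n := n) (w := w) hv₁ hv₂
    have hM' : IsLevel n w' v M := by
      rcases hM with ⟨i, hin, hi, hiv, hiM⟩ | hM
      · have hlt : i < n := by
          rcases hin.eq_or_lt with rfl | hlt
          · rw [hzn] at hi
            exact absurd hi (by decide)
          · exact hlt
        have hcongr : ∀ j, 1 ≤ j → j < i → isOne n w j = isOne n w' j :=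
          fun j hj hji => h j hj (by omega)
        refine Or.inl ⟨i, hin, ?_, ?_, ?_⟩
        · rw [← h i (isOne_iff.1 hi).1 hlt, hi]
        · rw [← onesBefore_congr hcongr, hiv]
        · rw [← zerosBefore_congr hcongr, hiM]
      · exact Or.inr (by omega)
    have := backTarget_of_isLevel hM ha
    have := backTarget_of_isLevel hM' (h₀ ▸ ha)
    omega) (by
    intro i hi₁ hi₂ hi
    have hi : ¬ (i = n ∨ i = zeroAt n w (zerosBefore n w n - 1)) := by simpa using hi
    push Not at hi
    have hlt : i < n := by omega
    rcases isZero_or_isOne (n := n) (w := w) hi₁ with hiz | hio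
    · have hiz' : IsZero n w' i := ⟨hi₁, h i hi₁ hlt ▸ hiz.2⟩
      have h₂ := zeroAt_zerosBefore hiz
      have h₃ := zeroAt_zerosBefore hiz'
      have h₅ : zerosBefore n w i = zerosBefore n w' i :=
        zerosBefore_congr fun j hj hji => h j hj (by omega)
      have h₆ := zerosBefore_lt_of_lt hiz hlt
      have h₇ : zerosBefore n w i + 1 < zerosBefore n w n := by
        by_contra hge
        apply hi.2
        rw [show zerosBefore n w n - 1 = zerosBefore n w i by omega, h₂]
      have h₈ := backTarget_eq (isDmax_of_zero hiz hi₂)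
      have h₉ := backTarget_eq (isDmax_of_zero hiz' hi₂)
      rw [h₈, h₉, ← h₅, zeroAt_congr h h₇]
    · rw [backTarget_one hio, backTarget_one (by rw [← h i hi₁ hlt, hio])])
  rw [Finset.card_singleton] at this
  have := Finset.card_le_two (a := n) (b := zeroAt n w (zerosBefore n w n - 1))
  omega

theorem exists_flip_last (hw : InRange n w) (hz : 2 ≤ zerosBefore n w n) :
    ∃ w', InRange n w' ∧ w' ≠ w ∧ graphDist n w w' ≤ 3 := by
  have hn := hw.pos
  have hn₁ : n ≠ 1 := by
    rintro rfl
    have := onesBefore_eq (n := 1) (w := w) (i := 1) le_rfl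
    omega
  obtain ⟨w', hw', h⟩ := exists_inRange (n := n)
    (f := fun i => if i = n then !(isOne n w n) else isOne n w i) hn
    (by simp [Ne.symm hn₁, hw.isOne_one])
  have hlast : isOne n w' n = !(isOne n w n) := by rw [h n hn le_rfl, if_pos rfl]
  have hcongr : ∀ j, 1 ≤ j → j < n → isOne n w j = isOne n w' j := by
    intro j hj hjn
    rw [h j hj hjn.le, if_neg hjn.ne]
  refine ⟨w', hw', ?_, ?_⟩
  · rintro rfl
    cases h' : isOne n w' n <;> simp [h'] at hlast
  · cases h' : isOne n w n
    · exact graphDist_flip_last_le h' (by rw [hlast, h']; rfl) hcongr hz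
    · rw [graphDist_comm]
      refine graphDist_flip_last_le (by rw [hlast, h']; rfl) h'
        (fun j hj hjn => (hcongr j hj hjn).symm) ?_
      rwa [← zerosBefore_congr hcongr]

end Generic

/-! ### From the internal block to the minimum -/

section Block

variable {n w : ℕ}

theorem isOne_eq_bit {i : ℕ} (h₁ : 1 ≤ i) (h₂ : i ≤ n) : isOne n w i = bit n w i := by
  simp [isOne, h₁, h₂]

theorem count_false_internalBlock (hw : InRange n w) (hn : 2 ≤ n) :
    (internalBlock n w).count false = zerosBefore n w n := by
  have key : ∀ m, m + 2 ≤ n →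
      ((List.range' 2 m).map (bit n w)).count false = zerosBefore n w (m + 2) := by
    intro m
    induction m with
    | zero =>
      intro _
      rw [zerosBefore_succ_of_one hw.isOne_one]
      simp [zerosBefore, Nat.count_succ, IsZero]
    | succ m ih =>
      intro hm
      rw [List.range'_1_concat, List.map_append, List.count_append, ih (by omega),
        show m + 1 + 2 = m + 2 + 1 by omega]
      have hbit := isOne_eq_bit (n := n) (w := w) (i := m + 2) (by omega) (by omega)
      rw [Nat.add_comm 2 m]
      cases h : bit n w (m + 2)
      · rw [zerosBefore_succ_of_zero ⟨by omega, hbit.trans h⟩]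
        simp [h]
      · rw [zerosBefore_succ_of_one (hbit.trans h)]
        simp [h]
  rw [internalBlock, key (n - 2) (by omega), show n - 2 + 2 = n by omega]

theorem three_le_of_internalBlock_ne_nil (h : internalBlock n w ≠ []) : 3 ≤ n := by
  by_contra hlt
  apply h
  simp [internalBlock, show n - 2 = 0 by omega]

theorem internalBlock_getElem? {j : ℕ} (h : j + 2 < n) :
    (internalBlock n w)[j]? = some (bit n w (j + 2)) := by
  rw [internalBlock, List.getElem?_map, List.getElem?_range' (by omega)]
  simp [Nat.add_comm]

theorem isOne_of_internalBlock {l r : ℕ} (hw : InRange n w)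
    (h : internalBlock n w = List.replicate l true ++ false :: List.replicate r true) :
    n = l + r + 3 ∧ ∀ i, 1 ≤ i → i < n → isOne n w i = decide (i ≠ l + 2) := by
  have hn : 3 ≤ n := three_le_of_internalBlock_ne_nil (w := w) (by rw [h]; simp)
  have hlen := congrArg List.length h
  simp [internalBlock] at hlen
  refine ⟨by omega, fun i h₁ h₂ => ?_⟩
  by_cases hi : i = 1
  · rw [hi, hw.isOne_one]; simp
  obtain ⟨j, rfl⟩ : ∃ j, i = j + 2 := ⟨i - 2, by omega⟩
  have h₃ := internalBlock_getElem? (w := w) h₂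
  rw [isOne_eq_bit h₁ h₂.le]
  rw [h] at h₃
  rcases lt_trichotomy j l with hlt | rfl | hgt
  · rw [List.getElem?_append_left (by simpa using hlt), List.getElem?_replicate, if_pos hlt,
      Option.some_inj] at h₃
    rw [← h₃]
    simp
    omega
  · rw [List.getElem?_append_right (by simp)] at h₃
    simp at h₃
    rw [h₃]
    simp
  · rw [List.getElem?_append_right (by simp; omega), List.length_replicate,
      show j - l = (j - l - 1) + 1 by omega, List.getElem?_cons_succ, List.getElem?_replicate,
      if_pos (by omega), Option.some_inj] at h₃
    rw [← h₃]
    simp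
    omega

theorem isMinVM_of_two_internal_zeros (hw : InRange n w)
    (h : 2 ≤ (internalBlock n w).count false) : IsMinVM n w 3 := by
  have hn : 3 ≤ n := three_le_of_internalBlock_ne_nil (w := w) (by rintro h'; simp [h'] at h)
  rw [count_false_internalBlock hw (by omega)] at h
  refine isMinVM_of_le (exists_flip_last hw h) fun w' hw' hne => three_le_graphDist hw hw' hne ?_
  by_contra hlt
  have := zerosBefore_mono (n := n) (w := w) (not_le.1 hlt).le
  rw [zerosBefore_zeroAt] at this
  omega

/-- The two competitors are the word with an additional zero at `n` and the word whose only zero is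
at `n`. -/
theorem OneZero.isMinVM {z : ℕ} (hw : InRange n w) (h : OneZero n w z) (hz : 2 ≤ z)
    (hzn : z < n) : IsMinVM n w (min (z + 2) (n + 3 - z)) := by
  refine isMinVM_of_le ?_ fun w' hw' hne => ?_
  · rcases le_total (z + 2) (n + 3 - z) with hle | hle
    · obtain ⟨w', hw', h'⟩ := exists_twoZeros hz hzn
      refine ⟨w', hw', ?_, by
        rw [min_eq_left hle]; exact graphDist_oneZero_twoZeros_le h h' (by omega)⟩
      rintro rfl
      have := h.2.2
      have := h'.2.2
      omega
    · obtain ⟨w', hw', h'⟩ := exists_oneZero (n := n) (z := n) (by omega) le_rfl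
      refine ⟨w', hw', ?_, by
        rw [min_eq_right hle]; exact graphDist_oneZero_oneZero_le h h' hzn⟩
      rintro rfl
      have := h.2
      have := h'.2
      omega
  · have := h.le_graphDist hw hw' hne hz hzn
    omega

/-- The two competitors come from deleting the zero at `n` and from moving the zero at `z` to `n -
1`. -/
theorem TwoZeros.isMinVM {z : ℕ} (hw : InRange n w) (h : TwoZeros n w z) (hz : 2 ≤ z)
    (hzn : z + 1 < n) : IsMinVM n w (min (z + 2) (n + 2 - z)) := by
  refine isMinVM_of_le ?_ fun w' hw' hne => ?_
  · rcases le_total (z + 2) (n + 2 - z) with hle | hle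
    · obtain ⟨w', hw', h'⟩ := exists_oneZero (n := n) hz (by omega)
      refine ⟨w', hw', ?_, by
        rw [min_eq_left hle, graphDist_comm]
        exact graphDist_oneZero_twoZeros_le h' h (by omega)⟩
      rintro rfl
      have := h.2.2
      have := h'.2.2
      omega
    · obtain ⟨w', hw', h'⟩ := exists_twoZeros (n := n) (z := n - 1) (by omega) (by omega)
      refine ⟨w', hw', ?_, by
        rw [min_eq_right hle]; exact graphDist_twoZeros_twoZeros_le h h' hzn⟩
      rintro rfl
      have := h.2.1
      have := h'.2.1
      omega
  · have := h.le_graphDist hw hw' hne hz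
    omega

theorem TwoZeros.isMinVM_last (hw : InRange n w) (h : TwoZeros n w (n - 1)) (hn : 3 ≤ n) :
    IsMinVM n w 4 := by
  refine isMinVM_of_le ?_ fun w' hw' hne => ?_
  · obtain ⟨w', hw', h'⟩ := exists_noZero (n := n) (by omega)
    refine ⟨w', hw', ?_, graphDist_twoZeros_no_zero_le h h'⟩
    rintro rfl
    have := h.2.1
    omega
  · have := h.le_graphDist hw hw' hne (by omega)
    omega

theorem isMinVM_of_no_zero (hw : InRange n w) (h : n < zeroAt n w 0) (hn : 4 ≤ n) :
    IsMinVM n w 4 := by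
  refine isMinVM_of_le ?_ fun w' hw' hne => four_le_graphDist_of_no_zero hw hw' hne h hn
  obtain ⟨w', hw', h'⟩ := exists_twoZeros (n := n) (z := n - 1) (by omega) (by omega)
  refine ⟨w', hw', ?_, by rw [graphDist_comm]; exact graphDist_twoZeros_no_zero_le h' h⟩
  rintro rfl
  have := h'.2.1
  omega

theorem OneZero.isMinVM_last (hw : InRange n w) (h : OneZero n w n) (hn : 4 ≤ n) :
    IsMinVM n w 4 := by
  refine isMinVM_of_le ?_ fun w' hw' hne => h.four_le_graphDist hw hw' hne hn
  obtain ⟨w', hw', h'⟩ := exists_oneZero (n := n) (z := n - 1) (by omega) (by omega)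
  refine ⟨w', hw', ?_, ?_⟩
  · rintro rfl
    have := h.2.1
    have := h'.2.1
    omega
  · rw [graphDist_comm]
    have := graphDist_oneZero_oneZero_le h' h (by omega)
    omega

end Block

end WRPG

theorem theorem1 (n w : ℕ) (hw : WRPG.InRange n w) :
    (2 ≤ (WRPG.internalBlock n w).count false → WRPG.IsMinVM n w 3) ∧
    (∀ ℓ r : ℕ,
      WRPG.internalBlock n w = List.replicate ℓ true ++ false :: List.replicate r true →
        (WRPG.bit n w n = false → 0 < r → WRPG.IsMinVM n w (4 + min ℓ (r - 1))) ∧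
        (WRPG.bit n w n = false → r = 0 → WRPG.IsMinVM n w 4) ∧
        (WRPG.bit n w n = true → WRPG.IsMinVM n w (4 + min ℓ r))) ∧
    (4 ≤ n → false ∉ WRPG.internalBlock n w → WRPG.IsMinVM n w 4) := by
  have hn := hw.pos
  refine ⟨WRPG.isMinVM_of_two_internal_zeros hw, fun ℓ r hB => ?_, fun hn₄ hB => ?_⟩
  · obtain ⟨hlen, hone⟩ := WRPG.isOne_of_internalBlock hw hB
    have hz : WRPG.isOne n w (ℓ + 2) = false := by rw [hone _ (by omega) (by omega)]; simp
    rw [← WRPG.isOne_eq_bit (w := w) hn le_rfl]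
    have htwo : WRPG.isOne n w n = false → WRPG.TwoZeros n w (ℓ + 2) := fun hlast =>
      WRPG.twoZeros_of_isOne (by omega) (by omega) hz hlast fun i h₁ h₂ hi => by
        rw [hone i h₁ h₂]; simp [hi]
    refine ⟨fun hlast hr => ?_, fun hlast hr => ?_, fun hlast => ?_⟩
    -- The internal zero is at `z = ℓ + 2` and `n = ℓ + r + 3`, so `0 < r` says that `z + 1 < n`.
    · rw [show 4 + min ℓ (r - 1) = min (ℓ + 2 + 2) (n + 2 - (ℓ + 2)) by omega]
      exact (htwo hlast).isMinVM hw (by omega) (by omega)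
    · have h := htwo hlast
      rw [show ℓ + 2 = n - 1 by omega] at h
      exact h.isMinVM_last hw (by omega)
    · have h : WRPG.OneZero n w (ℓ + 2) :=
        WRPG.oneZero_of_isOne (by omega) (by omega) hz fun i h₁ h₂ hi => by
          rcases h₂.eq_or_lt with rfl | h₂
          · exact hlast
          · rw [hone i h₁ h₂]; simp [hi]
      rw [show 4 + min ℓ r = min (ℓ + 2 + 2) (n + 3 - (ℓ + 2)) by omega]
      exact h.isMinVM hw (by omega) (by omega)
  · have hone : ∀ i, 1 ≤ i → i < n → WRPG.isOne n w i = true := by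
      intro i h₁ h₂
      by_cases hi : i = 1
      · rw [hi, hw.isOne_one]
      · rw [WRPG.isOne_eq_bit h₁ h₂.le]
        by_contra hb
        refine hB (List.mem_map.2 ⟨i, List.mem_range'_1.2 (by omega), ?_⟩)
        simpa using hb
    cases hlast : WRPG.isOne n w n
    · exact (WRPG.oneZero_of_isOne hn le_rfl hlast fun i h₁ h₂ hi =>
        hone i h₁ (by omega)).isMinVM_last hw hn₄
    · refine WRPG.isMinVM_of_no_zero hw (WRPG.noZero_of_isOne fun i h₁ h₂ => ?_) hn₄
      rcases h₂.eq_or_lt with rfl | h₂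
      · exact hlast
      · exact hone i h₁ h₂
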